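/- **Theorem (Complexity of search via QAOA).** For $n\ge 1$ let $N=2^n$ and consider $n$ qubits. Let $H_x=\sum_{j=1}^n X_j$, where $X_j$ is the Pauli $X$ matrix on qubit $j$, let $H_w=|w\rangle\langle w|$ for a bit string $w\in\{0,1\}^n$, and let $|+\rangle=(|0\rangle+|1\rangle)/\sqrt2$. The QAOA circuit of depth $p$ with angles $\gamma_k\in[0,2\pi)$, $\beta_k\in[0,\pi)$ is $$Q_w=e^{-i\beta_pH_x}e^{-i\gamma_pH_w}\cdots e^{-i\beta_1H_x}e^{-i\gamma_1H_w},\qquad |\psi_{p,w}(\gamma,\beta)\rangle=Q_w|+\rangle^{\otimes n}.$$ Put $$\alpha^*=\frac12\sum_{k=1}^n\frac{1}{k\,2^{n}}\binom nk=\frac1n+O\!\left(\frac1{n^2}\right),\qquad t^*=\frac{\pi}{2}\sqrt{2^n},$$ $H_1=-iH_w$, $H_2=-i\alpha^*H_x$, and let $S_q$ ($q$ even) be the Trotter–Suzuki formulas $$S_2(t)=e^{H_2t/2}e^{H_1t/2}e^{H_1t/2}e^{H_2t/2},\qquad S_{2k}(t)=S_{2k-2}(u_kt)^2\,S_{2k-2}((1-4u_k)t)\,S_{2k-2}(u_kt)^2,$$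 $$u_k=\frac{1}{4-4^{1/(2k-1)}}\qquad(k\ge 2).$$ There are, for every $n\ge1$, an even order $q\ge2$, a number of steps $r\ge1$, a depth $p=r\,5^{q/2-1}$ and angles $\gamma_k\in[0,2\pi)$, $\beta_k\in[0,\pi)$ for $1\le k\le p$, all depending on $n$ only and not on the target $w$, such that: 1. the circuit is the $r$-step Trotter–Suzuki discretization of the continuous-time quantum walk $e^{-i(\alpha^*H_x+H_w)t^*}$ on the hypercube, up to a global phase and an initial rotation generated by $H_x$ (which only changes $|+\rangle^{\otimes n}$ by a phase): there are real $\varphi,\theta$, depending on $n$ only, with $S_q(t^*/r)^r=e^{i\varphi}\,Q_w\,e^{-i\theta H_x}$ for all $w$; and $q/\sqrt n\to\sqrt{\ln 2/(2\ln 5)}$ as $n\to\infty$; 2. $p=O\!\left(2^{\frac n2+\sqrt n\sqrt{2\log_25}}\right)$; 3. $|\langle w|\psi_{p,w}(\gamma,\beta)\rangle|^2=1+O(1/n)$, uniformly in the target $w\in\{0,1\}^n$; 4. consequently $p=O(N^{1/2+c})$ for every $c>0$. -/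

import Mathlib

open Filter Topology

noncomputable section

/-- Operators on the state space of `n` qubits, in the computational basis. -/
abbrev QOp (n : ℕ) : Type := Matrix (Fin n → Bool) (Fin n → Bool) ℂ

/-- Vectors of the state space of `n` qubits, in the computational basis. -/
abbrev QVec (n : ℕ) : Type := (Fin n → Bool) → ℂ

/-- The computational basis vector `|w⟩`. -/
def ket {n : ℕ} (w : Fin n → Bool) : QVec n := Pi.single w 1

/-- The uniform superposition `|+⟩^{⊗ n}`, where `|+⟩ = (|0⟩ + |1⟩) / √2`. -/
def plusState (n : ℕ) : QVec n := fun _ => ((1 / √2 : ℝ) : ℂ) ^ n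

/-- The squared overlap `|⟨w|ψ⟩|²`. -/
def overlap {n : ℕ} (w : Fin n → Bool) (ψ : QVec n) : ℝ := ‖star (ket w) ⬝ᵥ ψ‖ ^ 2

/-- The Pauli matrix `X` on qubit `j`: it maps `|y⟩` to `|y with bit j flipped⟩`. -/
def pauliX {n : ℕ} (j : Fin n) : QOp n :=
  Matrix.of fun x y => if x = Function.update y j (!y j) then 1 else 0

/-- `H_x = ∑ⱼ Xⱼ`, the adjacency matrix of the `n`-dimensional hypercube. -/
def Hx (n : ℕ) : QOp n := ∑ j : Fin n, pauliX j

/-- `H_w = |w⟩⟨w|`. -/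
def Hw {n : ℕ} (w : Fin n → Bool) : QOp n := Matrix.vecMulVec (ket w) (star (ket w))

/-- `exp (-i s H)`. -/
def evolve {n : ℕ} (H : QOp n) (s : ℝ) : QOp n := NormedSpace.exp ((-Complex.I * (s : ℂ)) • H)

/-- The QAOA circuit of depth `p` with angles `γ 1, …, γ p` and `β 1, …, β p`, for the target `w`;
layer `1` acts first. -/
def qaoaCircuit {n : ℕ} (w : Fin n → Bool) (γ β : ℕ → ℝ) : ℕ → QOp n
  | 0 => 1
  | p + 1 => evolve (Hx n) (β (p + 1)) * evolve (Hw w) (γ (p + 1)) * qaoaCircuit w γ β p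

/-- The QAOA state of depth `p`. -/
def qaoaState {n : ℕ} (w : Fin n → Bool) (γ β : ℕ → ℝ) (p : ℕ) : QVec n :=
  (qaoaCircuit w γ β p).mulVec (plusState n)

/-- The Trotter–Suzuki product formula for `exp (t (H₁ + H₂))`:
`suzuki H₁ H₂ m` is the formula of order `q = 2 (m + 1)`. The step from order `2 (k - 1)` to
order `2 k`, where `k = m + 2`, uses `u = 1 / (4 - 4 ^ (1 / (2 k - 1)))`. -/
def suzuki {n : ℕ} (H₁ H₂ : QOp n) : ℕ → ℝ → QOp n
  | 0, t =>
      NormedSpace.exp (((t / 2 : ℝ) : ℂ) • H₂) * NormedSpace.exp (((t / 2 : ℝ) : ℂ) • H₁) *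
        (NormedSpace.exp (((t / 2 : ℝ) : ℂ) • H₁) * NormedSpace.exp (((t / 2 : ℝ) : ℂ) • H₂))
  | m + 1, t =>
      let u : ℝ := 1 / (4 - (4 : ℝ) ^ (1 / (2 * (m : ℝ) + 3)))
      suzuki H₁ H₂ m (u * t) ^ 2 * suzuki H₁ H₂ m ((1 - 4 * u) * t) *
        suzuki H₁ H₂ m (u * t) ^ 2

/-- The optimal hopping rate of the hypercube walk,
`α* = ½ ∑_{k = 1}^n 2^{-n} (n choose k) / k = 1 / n + O(1 / n²)`. -/
def alphaStar (n : ℕ) : ℝ :=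
  (1 / 2) * ∑ k ∈ Finset.Icc 1 n, ((n.choose k : ℝ) / 2 ^ n) / k

/-- The walk time `t* = (π / 2) √(2^n)`. -/
def tStar (n : ℕ) : ℝ := Real.pi / 2 * √((2 : ℝ) ^ n)

/-- The walk `exp (-i t* (α* H_x + H_w))`, discretized in `r` equal steps, each replaced by the
Trotter–Suzuki formula of order `2 (m + 1)` with `H₁ = -i H_w` and `H₂ = -i α* H_x`. -/
def trotterWalk {n : ℕ} (w : Fin n → Bool) (m r : ℕ) : QOp n :=
  suzuki ((-Complex.I) • Hw w) ((-Complex.I * (alphaStar n : ℂ)) • Hx n) m (tStar n / r) ^ r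

end

/-! The walk. Let `s` be the uniform state, `ε = ⟨w|s⟩ = 2^(-n/2)`, and `P_k` the projection onto
the eigenspace of `Hx` for `n - 2k`. The vector `g = ∑_{k ≥ 1} (2 α* k)⁻¹ P_k |w⟩` solves `α* (n -
Hx) g = |w⟩ - ε s`, and `α*` is exactly the value for which `⟨w|g⟩ = 1`. Hence, after subtracting
the scalar `α* n`, the walk Hamiltonian sends `g` to `ε s` and `s` to `ε |w⟩`. For binomially
distributed `k` the ratio `1 / (2 α* k)` concentrates at 1, so `g` is within `O(1/√n)` of `|w⟩`
(`sum_choose_mul_alphaStar_sq_le`). The walk is therefore almost a rotation by angle `ε t` in the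
plane of `s` and `g`, and `t* = π / (2 ε)` is a quarter turn; `norm_exp_apply_sub_le` keeps the
accumulated error at `O(1/√n)` (`exists_norm_walk_sub_le`). The squared overlap loses only the
square of this error (`abs_overlap_sub_one_le`).

The discretization. In complex time the Suzuki formula is entire and agrees with the exponential to
order `q + 1` at 0 (`suzukiC_agreeToOrder`). Crude growth bounds and the maximum principle then give
a step error `2e (|z| L)^(q+1)` with `L = 3^(q/2)`, without any commutator estimate
(`norm_suzukiC_sub_exp_le`).

The parameters. With `T = t* L`, taking `r ≈ T (T n)^(1/q)` steps makes the total error `O(1/n)`.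
For `q` of order `√n` the depth is then at most a constant times `2^(n/2) 2^(n/(2q)) 5^q`, and `q =
√(n log 2 / (2 log 5))` minimizes this. Merging adjacent `Hx` rotations and reducing angles modulo
their periods turns the product into a QAOA circuit (`exists_angles`). -/

/-! ### Order and error of the Trotter–Suzuki formulas in a Banach algebra. -/

section SuzukiOrder

variable {A : Type*} [NormedRing A] [NormedAlgebra ℂ A]

theorem exp_smul_mul_exp_smul [CompleteSpace A] (x : A) (a b : ℂ) :
    NormedSpace.exp (a • x) * NormedSpace.exp (b • x) = NormedSpace.exp ((a + b) • x) := by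
  let _ : NormedAlgebra ℚ A := NormedAlgebra.restrictScalars ℚ ℂ A
  rw [add_smul, NormedSpace.exp_add_of_commute]
  exact ((Commute.refl x).smul_left a).smul_right b

theorem exp_natCast_smul [CompleteSpace A] (x : A) (a : ℂ) (k : ℕ) :
    NormedSpace.exp (a • x) ^ k = NormedSpace.exp (((k : ℂ) * a) • x) := by
  induction k with
  | zero => simp
  | succ k ih => rw [pow_succ, ih, exp_smul_mul_exp_smul]; push_cast; ring_nf

theorem differentiable_exp_smul [CompleteSpace A] (x : A) :
    Differentiable ℂ (fun z : ℂ => NormedSpace.exp (z • x)) :=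
  fun z => (hasDerivAt_exp_smul_const (𝕂 := ℂ) x z).differentiableAt

theorem norm_exp_smul_le [CompleteSpace A] [NormOneClass A] (x : A) (z : ℂ) :
    ‖NormedSpace.exp (z • x)‖ ≤ Real.exp (‖z‖ * ‖x‖) := by
  rw [← norm_smul]
  generalize z • x = y
  have h := NormedSpace.exp_series_hasSum_exp' (𝕂 := ℂ) y
  have h2 := NormedSpace.expSeries_div_hasSum_exp (𝔸 := ℝ) ‖y‖
  rw [← Real.exp_eq_exp_ℝ] at h2
  refine h.norm_le_of_bounded h2 fun i => ?_
  rw [norm_smul, norm_inv, Complex.norm_natCast, div_eq_inv_mul]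
  gcongr
  exact norm_pow_le y i

/-- The Trotter–Suzuki formulas in a Banach algebra, with complex time. -/
noncomputable def suzukiC (H₁ H₂ : A) : ℕ → ℂ → A
  | 0, z =>
      NormedSpace.exp ((z / 2) • H₂) * NormedSpace.exp ((z / 2) • H₁) *
        (NormedSpace.exp ((z / 2) • H₁) * NormedSpace.exp ((z / 2) • H₂))
  | m + 1, z =>
      let u : ℂ := ((1 / (4 - (4 : ℝ) ^ (1 / (2 * (m : ℝ) + 3))) : ℝ) : ℂ)
      suzukiC H₁ H₂ m (u * z) ^ 2 * suzukiC H₁ H₂ m ((1 - 4 * u) * z) *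
        suzukiC H₁ H₂ m (u * z) ^ 2

/-- The coefficient `1 / (4 - 4 ^ (1 / (2 m + 3)))` of the Suzuki recursion. -/
noncomputable def suzukiCoeff (m : ℕ) : ℝ := 1 / (4 - (4 : ℝ) ^ (1 / (2 * (m : ℝ) + 3)))

theorem suzukiC_succ (H₁ H₂ : A) (m : ℕ) (z : ℂ) :
    suzukiC H₁ H₂ (m + 1) z =
      suzukiC H₁ H₂ m (suzukiCoeff m * z) ^ 2 * suzukiC H₁ H₂ m ((1 - 4 * suzukiCoeff m) * z) *
        suzukiC H₁ H₂ m (suzukiCoeff m * z) ^ 2 := rfl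

theorem suzukiC_zero_right (H₁ H₂ : A) (m : ℕ) : suzukiC H₁ H₂ m 0 = 1 := by
  induction m with
  | zero => simp [suzukiC]
  | succ m ih => simp [suzukiC_succ, ih]

theorem differentiable_suzukiC [CompleteSpace A] (H₁ H₂ : A) (m : ℕ) : Differentiable ℂ (suzukiC
    H₁ H₂ m) := by
  induction m with
  | zero =>
    have h : ∀ x : A, Differentiable ℂ (fun z : ℂ => NormedSpace.exp ((z / 2) • x)) := fun x =>
      (differentiable_exp_smul x).comp (differentiable_id.div_const 2)
    exact ((h H₂).mul (h H₁)).mul ((h H₁).mul (h H₂))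
  | succ m ih =>
    have h : ∀ c : ℂ, Differentiable ℂ (fun z : ℂ => suzukiC H₁ H₂ m (c * z)) := fun c =>
      ih.comp (differentiable_id.const_mul c)
    exact (((h _).pow 2).mul (h _)).mul ((h _).pow 2)

theorem suzukiC_mul_neg [CompleteSpace A] (H₁ H₂ : A) (m : ℕ) (z : ℂ) :
    suzukiC H₁ H₂ m z * suzukiC H₁ H₂ m (-z) = 1 := by
  induction m generalizing z with
  | zero =>
    have h : ∀ x y : A, NormedSpace.exp ((z / 2) • x) * (NormedSpace.exp ((-z / 2) • x) * y) = y
        := by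
      intro x y
      rw [← mul_assoc, exp_smul_mul_exp_smul]
      simp [neg_div]
    have h' : ∀ x : A, NormedSpace.exp ((z / 2) • x) * NormedSpace.exp ((-z / 2) • x) = 1 := by
      intro x
      rw [exp_smul_mul_exp_smul]
      simp [neg_div]
    simp only [suzukiC, mul_assoc, h, h']
  | succ m ih =>
    have h : ∀ (c : ℂ) (y : A), suzukiC H₁ H₂ m (c * z) * (suzukiC H₁ H₂ m (c * -z) * y) = y := by
      intro c y
      rw [← mul_assoc, mul_neg, ih, one_mul]
    have h' : ∀ (c : ℂ), suzukiC H₁ H₂ m (c * z) * suzukiC H₁ H₂ m (c * -z) = 1 := by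
      intro c
      rw [mul_neg, ih]
    simp only [suzukiC_succ, mul_assoc, h, h', pow_two]

theorem four_rpow_mem (m : ℕ) :
    1 ≤ (4 : ℝ) ^ (1 / (2 * (m : ℝ) + 3)) ∧ (4 : ℝ) ^ (1 / (2 * (m : ℝ) + 3)) ≤ 2 := by
  have hm : (0 : ℝ) ≤ m := m.cast_nonneg
  constructor
  · exact Real.one_le_rpow (by norm_num) (by positivity)
  · calc (4 : ℝ) ^ (1 / (2 * (m : ℝ) + 3)) ≤ 4 ^ (1 / 2 : ℝ) := by
          apply Real.rpow_le_rpow_of_exponent_le (by norm_num)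
          apply one_div_le_one_div_of_le <;> linarith
      _ = 2 := by
          rw [show (4 : ℝ) = 2 ^ (2 : ℝ) by norm_num, ← Real.rpow_mul (by norm_num)]
          norm_num

theorem suzukiCoeff_mem (m : ℕ) : 1 / 4 ≤ suzukiCoeff m ∧ suzukiCoeff m ≤ 1 / 2 := by
  obtain ⟨h1, h2⟩ := four_rpow_mem m
  unfold suzukiCoeff
  constructor <;> apply one_div_le_one_div_of_le <;> linarith

/-- With `v = 4^(1/(2m+3))` and `u = 1/(4-v)` one has `1 - 4u = -v u`; the exponent is odd and
`v^(2m+3) = 4`. This is the cancellation that raises the order. -/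
theorem suzukiCoeff_order (m : ℕ) :
    4 * suzukiCoeff m ^ (2 * m + 3) + (1 - 4 * suzukiCoeff m) ^ (2 * m + 3) = 0 := by
  obtain ⟨h1, h2⟩ := four_rpow_mem m
  have hpow : ((4 : ℝ) ^ (1 / (2 * (m : ℝ) + 3))) ^ (2 * m + 3) = 4 := by
    rw [← Real.rpow_natCast, ← Real.rpow_mul (by norm_num)]
    push_cast
    rw [one_div_mul_cancel (by positivity), Real.rpow_one]
  unfold suzukiCoeff
  set v := (4 : ℝ) ^ (1 / (2 * (m : ℝ) + 3)) with hv
  have h3 : 4 - v ≠ 0 := by linarith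
  have : 1 - 4 * (1 / (4 - v)) = -v * (1 / (4 - v)) := by field_simp; ring
  rw [this, mul_pow, Odd.neg_pow ⟨m + 1, by ring⟩, hpow]
  ring

/-- Each recursion level multiplies the total absolute time by at most `4 · 1/2 + 1 = 3`, because
`1/4 ≤ u ≤ 1/2`. -/
theorem norm_suzukiC_le [CompleteSpace A] [NormOneClass A] (H₁ H₂ : A) (m : ℕ) (z : ℂ) :
    ‖suzukiC H₁ H₂ m z‖ ≤ Real.exp (‖z‖ * ((‖H₁‖ + ‖H₂‖) * 3 ^ m)) := by
  induction m generalizing z with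
  | zero =>
    have h : ∀ x : A, ‖NormedSpace.exp ((z / 2) • x)‖ ≤ Real.exp (‖z‖ / 2 * ‖x‖) := by
      intro x
      simpa using norm_exp_smul_le x (z / 2)
    calc ‖suzukiC H₁ H₂ 0 z‖ ≤ Real.exp (‖z‖ / 2 * ‖H₂‖) * Real.exp (‖z‖ / 2 * ‖H₁‖) *
          (Real.exp (‖z‖ / 2 * ‖H₁‖) * Real.exp (‖z‖ / 2 * ‖H₂‖)) :=
          norm_mul_le_of_le (norm_mul_le_of_le (h _) (h _)) (norm_mul_le_of_le (h _) (h _))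
      _ = _ := by
          rw [← Real.exp_add, ← Real.exp_add, ← Real.exp_add]
          ring_nf
  | succ m ih =>
    obtain ⟨h1, h2⟩ := suzukiCoeff_mem m
    set u := suzukiCoeff m with hu
    set K := (‖H₁‖ + ‖H₂‖) * 3 ^ m with hK
    have hK0 : 0 ≤ K := by positivity
    have ha : ‖suzukiC H₁ H₂ m (u * z)‖ ≤ Real.exp (1 / 2 * ‖z‖ * K) := by
      refine (ih _).trans (Real.exp_le_exp.2 ?_)
      rw [norm_mul, Complex.norm_real, Real.norm_eq_abs, abs_of_nonneg (by linarith)]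
      gcongr
    have hb : ‖suzukiC H₁ H₂ m ((1 - 4 * u) * z)‖ ≤ Real.exp (1 * ‖z‖ * K) := by
      refine (ih _).trans (Real.exp_le_exp.2 ?_)
      have : (1 - 4 * (u : ℂ)) = ((1 - 4 * u : ℝ) : ℂ) := by push_cast; ring
      rw [norm_mul, this, Complex.norm_real, Real.norm_eq_abs]
      gcongr
      rw [abs_le]
      constructor <;> linarith
    have ha2 : ‖suzukiC H₁ H₂ m (u * z) ^ 2‖ ≤ Real.exp (1 * ‖z‖ * K) := by
      rw [pow_two]
      refine (norm_mul_le_of_le ha ha).trans_eq ?_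
      rw [← Real.exp_add]
      ring_nf
    rw [suzukiC_succ]
    refine (norm_mul_le_of_le (norm_mul_le_of_le ha2 hb) ha2).trans_eq ?_
    rw [← Real.exp_add, ← Real.exp_add, pow_succ]
    simp only [hK]
    ring_nf

/-- The entire functions `f` and `g` agree at `0` to order `k`, and `c` is the leading coefficient
of the difference. -/
def AgreeToOrder (k : ℕ) (f g : ℂ → A) (c : A) : Prop :=
  ∃ h : ℂ → A, Differentiable ℂ h ∧ h 0 = c ∧ ∀ z, f z - g z = z ^ k • h z

/-- Leading coefficients add because the other factors equal 1 at 0. -/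
theorem AgreeToOrder.mul {k : ℕ} {f g f' g' : ℂ → A} {c c' : A} (h : AgreeToOrder k f g c)
    (h' : AgreeToOrder k f' g' c') (hg : Differentiable ℂ g) (hf' : Differentiable ℂ f')
    (hg0 : g 0 = 1) (hf0 : f' 0 = 1) :
    AgreeToOrder k (fun z => f z * f' z) (fun z => g z * g' z) (c + c') := by
  obtain ⟨e, he, he0, hfg⟩ := h
  obtain ⟨e', he', he0', hfg'⟩ := h'
  refine ⟨fun z => e z * f' z + g z * e' z, (he.mul hf').add (hg.mul he'), by simp [*], fun z => ?_⟩
  rw [smul_add, ← smul_mul_assoc, ← mul_smul_comm, ← hfg, ← hfg']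
  noncomm_ring

theorem AgreeToOrder.comp_mul {k : ℕ} {f g : ℂ → A} {c : A} (h : AgreeToOrder k f g c) (u : ℂ) :
    AgreeToOrder k (fun z => f (u * z)) (fun z => g (u * z)) (u ^ k • c) := by
  obtain ⟨e, he, he0, hfg⟩ := h
  refine ⟨fun z => u ^ k • e (u * z), (he.comp (differentiable_id.const_mul u)).const_smul (u ^ k),
    by simp [he0], fun z => ?_⟩
  simp only [hfg, mul_pow, smul_smul, mul_comm]

theorem AgreeToOrder.succ [CompleteSpace A] {k : ℕ} {f g : ℂ → A} (h : AgreeToOrder k f g 0) :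
    ∃ c, AgreeToOrder (k + 1) f g c := by
  obtain ⟨e, he, he0, hfg⟩ := h
  refine ⟨_, dslope e 0, ?_, rfl, fun z => ?_⟩
  · rw [← differentiableOn_univ] at he ⊢
    exact (Complex.differentiableOn_dslope univ_mem).2 he
  · have := sub_smul_dslope e 0 z
    rw [he0, sub_zero, sub_zero] at this
    rw [hfg, pow_succ, mul_smul, this]

/-- Time symmetry kills even orders: `f(z) f(-z) = g(z) g(-z)` gives `e(z) f(-z) + g(z) e(-z) = 0`
off 0, where `e` is the quotient `(f - g) / z^k`, and letting `z → 0` gives `2c = 0`. -/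
theorem AgreeToOrder.eq_zero_of_even {k : ℕ} {f g : ℂ → A} {c : A} (h : AgreeToOrder k f g c)
    (hk : Even k) (hf : Differentiable ℂ f) (hg : Differentiable ℂ g) (hf0 : f 0 = 1)
    (hg0 : g 0 = 1) (hff : ∀ z, f z * f (-z) = 1) (hgg : ∀ z, g z * g (-z) = 1) : c = 0 := by
  obtain ⟨e, he, he0, hfg⟩ := h
  have hz : ∀ z : ℂ, z ≠ 0 → e z * f (-z) + g z * e (-z) = 0 := by
    intro z hz
    have h1 : z ^ k • (e z * f (-z) + g z * e (-z)) = 0 := by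
      have h2 := hfg (-z)
      rw [hk.neg_pow] at h2
      rw [smul_add, ← smul_mul_assoc, ← mul_smul_comm, ← hfg, ← h2, sub_mul, mul_sub, hff, hgg]
      simp
    exact (smul_eq_zero.1 h1).resolve_left (pow_ne_zero _ hz)
  have hcont : Continuous (fun z => e z * f (-z) + g z * e (-z)) :=
    (he.continuous.mul (hf.continuous.comp continuous_neg)).add
      (hg.continuous.mul (he.continuous.comp continuous_neg))
  have hlim := hcont.continuousAt (x := 0) |>.tendsto.mono_left (nhdsWithin_le_nhds (s := {0}ᶜ))
  have h0 : Tendsto (fun z => e z * f (-z) + g z * e (-z)) (𝓝[≠] 0) (𝓝 0) :=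
    tendsto_const_nhds.congr' (by
      filter_upwards [self_mem_nhdsWithin] with z hz' using (hz z hz').symm)
  have := tendsto_nhds_unique hlim h0
  simp only [neg_zero, hf0, hg0, he0, mul_one, one_mul] at this
  have h2 : (2 : ℂ) • c = 0 := by rw [two_smul, this]
  exact (smul_eq_zero.1 h2).resolve_left two_ne_zero

theorem exp_smul_mul_neg [CompleteSpace A] (x : A) (z : ℂ) :
    NormedSpace.exp (z • x) * NormedSpace.exp ((-z) • x) = 1 := by
  rw [exp_smul_mul_exp_smul]; simp

/-- In the recursion step the coefficient at the odd order `2m+3` vanishes by `suzukiCoeff_order`,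
and the next one, at even order, by symmetry, so two orders are gained. -/
theorem suzukiC_agreeToOrder [CompleteSpace A] (H₁ H₂ : A) (m : ℕ) :
    ∃ c, AgreeToOrder (2 * m + 3) (suzukiC H₁ H₂ m)
      (fun z => NormedSpace.exp (z • (H₁ + H₂))) c := by
  have hE := differentiable_exp_smul (H₁ + H₂)
  have hE0 : NormedSpace.exp ((0 : ℂ) • (H₁ + H₂)) = 1 := by simp
  have upgrade : ∀ (l k : ℕ) (c : A), AgreeToOrder k (suzukiC H₁ H₂ l)
      (fun z => NormedSpace.exp (z • (H₁ + H₂))) c → Even k →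
      ∃ c, AgreeToOrder (k + 1) (suzukiC H₁ H₂ l)
        (fun z => NormedSpace.exp (z • (H₁ + H₂))) c := by
    intro l k c h hk
    have := h.eq_zero_of_even hk (differentiable_suzukiC H₁ H₂ l) hE (suzukiC_zero_right ..) hE0
      (suzukiC_mul_neg H₁ H₂ l) (exp_smul_mul_neg _)
    subst this
    exact h.succ
  induction m with
  | zero =>
    have h0 : AgreeToOrder 0 (suzukiC H₁ H₂ 0) (fun z => NormedSpace.exp (z • (H₁ + H₂))) 0 :=
      ⟨fun z => suzukiC H₁ H₂ 0 z - NormedSpace.exp (z • (H₁ + H₂)),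
        (differentiable_suzukiC H₁ H₂ 0).sub hE, by simp [suzukiC_zero_right], by simp⟩
    obtain ⟨c, h1⟩ := h0.succ
    have hc : c = 0 := by
      obtain ⟨e, he, he0, hfg⟩ := h1
      have hd : ∀ x : A, HasDerivAt (fun z : ℂ => NormedSpace.exp ((z / 2) • x))
          ((1 / 2 : ℂ) • x) 0 := by
        intro x
        have h1 := hasDerivAt_exp_smul_const (𝕂 := ℂ) x ((0 : ℂ) / 2)
        have h2 := HasDerivAt.scomp (0 : ℂ) h1 ((hasDerivAt_id (0 : ℂ)).div_const 2)
        simpa [Function.comp_def] using h2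
      have hS : HasDerivAt (suzukiC H₁ H₂ 0) (H₁ + H₂) 0 := by
        have := ((hd H₂).mul (hd H₁)).mul ((hd H₁).mul (hd H₂))
        convert this using 1
        · rfl
        · simp
          module
      have hX : HasDerivAt (fun z : ℂ => NormedSpace.exp (z • (H₁ + H₂))) (H₁ + H₂) 0 := by
        simpa using hasDerivAt_exp_smul_const (𝕂 := ℂ) (H₁ + H₂) 0
      have h3 := hS.sub hX
      have h4 : HasDerivAt (fun z : ℂ => z ^ (0 + 1) • e z) (e 0) 0 := by
        have : HasDerivAt (fun z : ℂ => id z • e z) (id (0 : ℂ) • deriv e 0 + (1 : ℂ) • e 0) 0 :=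
          (hasDerivAt_id (0 : ℂ)).smul (he 0).hasDerivAt
        simpa using this
      have h5 : (suzukiC H₁ H₂ 0 - fun z => NormedSpace.exp (z • (H₁ + H₂))) =
          (fun z : ℂ => z ^ (0 + 1) • e z) := funext hfg
      rw [h5] at h3
      rw [← he0, h4.unique h3, sub_self]
    subst hc
    obtain ⟨c, h2⟩ := h1.succ
    exact upgrade 0 2 c h2 (by decide)
  | succ m ih =>
    obtain ⟨c, ih⟩ := ih
    set u : ℂ := (suzukiCoeff m : ℂ) with hu
    have hdS : ∀ a : ℂ, Differentiable ℂ (fun z : ℂ => suzukiC H₁ H₂ m (a * z)) := fun a =>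
      (differentiable_suzukiC H₁ H₂ m).comp (differentiable_id.const_mul a)
    have hdE : ∀ a : ℂ, Differentiable ℂ (fun z : ℂ => NormedSpace.exp ((a * z) • (H₁ + H₂))) :=
      fun a => hE.comp (differentiable_id.const_mul a)
    have hS0 : ∀ a : ℂ, suzukiC H₁ H₂ m (a * 0) = 1 := fun a => by
      rw [mul_zero, suzukiC_zero_right]
    have hE0' : ∀ a : ℂ, NormedSpace.exp ((a * 0) • (H₁ + H₂)) = 1 := fun a => by simp
    have h1 := ih.comp_mul u
    have h2 := h1.mul h1 (hdE _) (hdS _) (hE0' _) (hS0 _)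
    have h3 := ih.comp_mul (1 - 4 * u)
    have h4 := h2.mul h3 ((hdE _).mul (hdE _)) (hdS _) (by simp) (hS0 _)
    have h5 := h4.mul h2 (((hdE _).mul (hdE _)).mul (hdE _)) ((hdS _).mul (hdS _)) (by simp)
      (by simp [suzukiC_zero_right])
    have hc : u ^ (2 * m + 3) • c + u ^ (2 * m + 3) • c + (1 - 4 * u) ^ (2 * m + 3) • c +
        (u ^ (2 * m + 3) • c + u ^ (2 * m + 3) • c) = 0 := by
      have h6 : 4 * u ^ (2 * m + 3) + (1 - 4 * u) ^ (2 * m + 3) = 0 := by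
        have := suzukiCoeff_order m
        rw [hu]
        exact_mod_cast this
      rw [← add_smul, ← add_smul, ← add_smul]
      rw [show u ^ (2 * m + 3) + u ^ (2 * m + 3) + (1 - 4 * u) ^ (2 * m + 3) +
        (u ^ (2 * m + 3) + u ^ (2 * m + 3)) = 4 * u ^ (2 * m + 3) + (1 - 4 * u) ^ (2 * m + 3) by
          ring, h6, zero_smul]
    rw [hc] at h5
    obtain ⟨c', h6⟩ := h5.succ
    have h7 : AgreeToOrder (2 * m + 3 + 1) (suzukiC H₁ H₂ (m + 1))
        (fun z => NormedSpace.exp (z • (H₁ + H₂))) c' := by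
      convert h6 using 2 with z z
      · rw [suzukiC_succ, pow_two]
      · simp only [exp_smul_mul_exp_smul]
        congr 2
        ring
    exact upgrade _ _ _ h7 ⟨m + 2, by ring⟩

/-- A Schwarz lemma: the maximum principle is applied to the quotient of `f - g` by `z^k`. -/
theorem AgreeToOrder.norm_sub_le {k : ℕ} {f g : ℂ → A} {c : A} (h : AgreeToOrder k f g c)
    {R M : ℝ} (hR : 0 < R) (hM : ∀ z, ‖z‖ = R → ‖f z - g z‖ ≤ M) {z : ℂ} (hz : ‖z‖ ≤ R) :
    ‖f z - g z‖ ≤ M * (‖z‖ / R) ^ k := by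
  obtain ⟨e, he, -, hfg⟩ := h
  have hb : ‖e z‖ ≤ M / R ^ k := by
    apply Complex.norm_le_of_forall_mem_frontier_norm_le (U := Metric.ball (0 : ℂ) R)
      Metric.isBounded_ball he.diffContOnCl
    · intro w hw
      rw [frontier_ball _ hR.ne', mem_sphere_zero_iff_norm] at hw
      have := hM w hw
      rw [hfg, norm_smul, norm_pow, hw] at this
      rw [le_div_iff₀ (by positivity)]
      linarith
    · rw [closure_ball _ hR.ne']
      simpa using hz
  rw [hfg, norm_smul, norm_pow, div_pow]
  calc ‖z‖ ^ k * ‖e z‖ ≤ ‖z‖ ^ k * (M / R ^ k) := by gcongr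
    _ = _ := by ring

/-- The error of one Trotter–Suzuki step. -/
theorem norm_suzukiC_sub_exp_le [CompleteSpace A] [NormOneClass A] (H₁ H₂ : A) (m : ℕ) {L : ℝ}
    (hL : 0 < L)
    (hH : (‖H₁‖ + ‖H₂‖) * 3 ^ m ≤ L) {z : ℂ} (hz : ‖z‖ * L ≤ 1) :
    ‖suzukiC H₁ H₂ m z - NormedSpace.exp (z • (H₁ + H₂))‖ ≤
      2 * Real.exp 1 * (‖z‖ * L) ^ (2 * m + 3) := by
  obtain ⟨c, h⟩ := suzukiC_agreeToOrder H₁ H₂ m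
  -- On the circle of radius `1 / L` the formula and the exponential both have norm at most `e`.
  have := h.norm_sub_le (R := 1 / L) (M := 2 * Real.exp 1) (by positivity) ?_ (z := z) ?_
  · simpa using this
  · intro w hw
    have h1 : ‖w‖ * L = 1 := by rw [hw]; field_simp
    have h2 : ‖suzukiC H₁ H₂ m w‖ ≤ Real.exp 1 := by
      refine (norm_suzukiC_le H₁ H₂ m w).trans (Real.exp_le_exp.2 ?_)
      rw [← h1]
      gcongr
    have h3 : ‖NormedSpace.exp (w • (H₁ + H₂))‖ ≤ Real.exp 1 := by
      refine (norm_exp_smul_le _ w).trans (Real.exp_le_exp.2 ?_)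
      rw [← h1]
      gcongr
      refine (norm_add_le _ _).trans (le_trans ?_ hH)
      exact le_mul_of_one_le_right (by positivity) (one_le_pow₀ (by norm_num))
    calc _ ≤ _ := norm_sub_le _ _
      _ ≤ _ := by linarith
  · rwa [le_div_iff₀ hL]

end SuzukiOrder

/-! ### Binomial moments and the hopping rate. -/

section Binomial

/-- Variance plus squared bias of a fair binomial variable. Pascal's rule replaces `c` by `c ± 1/2`,
hence the general `c` in the induction. -/
theorem sum_choose_mul_sq (M : ℕ) (c : ℝ) :
    ∑ j ∈ Finset.range (M + 1), (M.choose j : ℝ) * ((j : ℝ) - M / 2 - c) ^ 2 =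
      2 ^ M * ((M : ℝ) / 4 + c ^ 2) := by
  induction M generalizing c with
  | zero => simp
  | succ M ih =>
    have h := Finset.sum_choose_succ_mul
      (fun j _ => ((j : ℝ) - ((M + 1 : ℕ) : ℝ) / 2 - c) ^ 2) M
    rw [h]
    have h1 := ih (c + 1 / 2)
    have h2 := ih (c - 1 / 2)
    have e1 : ∑ i ∈ Finset.range (M + 1), (M.choose i : ℝ) * ((i : ℝ) - ((M + 1 : ℕ) : ℝ) / 2 -
        c) ^ 2
        = ∑ j ∈ Finset.range (M + 1), (M.choose j : ℝ) * ((j : ℝ) - M / 2 - (c + 1 / 2)) ^ 2 := by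
      refine Finset.sum_congr rfl fun i _ => ?_
      push_cast
      ring
    have e2 : ∑ i ∈ Finset.range (M + 1),
        (M.choose i : ℝ) * (((i + 1 : ℕ) : ℝ) - ((M + 1 : ℕ) : ℝ) / 2 - c) ^ 2
        = ∑ j ∈ Finset.range (M + 1), (M.choose j : ℝ) * ((j : ℝ) - M / 2 - (c - 1 / 2)) ^ 2 := by
      refine Finset.sum_congr rfl fun i _ => ?_
      push_cast
      ring
    rw [e1, e2, h1, h2]
    push_cast
    ring

theorem sum_choose_mul_eq_sum_finset (n : ℕ) (f : ℕ → ℝ) :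
    ∑ S : Finset (Fin n), f S.card = ∑ k ∈ Finset.range (n + 1), (n.choose k : ℝ) * f k := by
  have := Finset.sum_powerset_apply_card f (x := (Finset.univ : Finset (Fin n)))
  simpa using this

theorem alphaStar_eq (n : ℕ) :
    ∑ k ∈ Finset.range (n + 1), (n.choose k : ℝ) * (1 / k) = 2 ^ n * (2 * alphaStar n) := by
  rw [alphaStar, Finset.range_eq_Ico, Finset.sum_eq_sum_Ico_succ_bot (by omega)]
  have : Finset.Ico (0 + 1) (n + 1) = Finset.Icc 1 n := by ext; simp
  rw [this]
  simp only [Nat.cast_zero, div_zero, mul_zero, zero_add, one_div, Finset.mul_sum]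
  exact Finset.sum_congr rfl fun k _ => by field_simp

theorem alphaStar_pos {n : ℕ} (hn : 1 ≤ n) : 0 < alphaStar n := by
  rw [alphaStar]
  refine mul_pos (by norm_num) (Finset.sum_pos (fun k hk => ?_) ⟨1, by simp [hn]⟩)
  rw [Finset.mem_Icc] at hk
  have : 0 < n.choose k := Nat.choose_pos hk.2
  have : 0 < k := hk.1
  positivity

theorem choose_div_succ (n k : ℕ) :
    (n.choose k : ℝ) / (k + 1) = ((n + 1).choose (k + 1) : ℝ) / (n + 1) := by
  have := Nat.add_one_mul_choose_eq n k
  rw [div_eq_div_iff (by positivity) (by positivity)]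
  exact_mod_cast (by linarith : n.choose k * (n + 1) = (n + 1).choose (k + 1) * (k + 1))

/-- Absorbs the weight `1/k²`, up to a constant, into a binomial coefficient, so that an inverse
moment becomes an ordinary variance. -/
theorem choose_div_succ_mul_succ (n k : ℕ) :
    (n.choose k : ℝ) / ((k + 1) * (k + 2)) =
      ((n + 2).choose (k + 2) : ℝ) / ((n + 1) * (n + 2)) := by
  have h1 := choose_div_succ n k
  have h2 := choose_div_succ (n + 1) (k + 1)
  push_cast at h2
  rw [← div_div, h1, div_right_comm, show (k : ℝ) + 2 = k + 1 + 1 by ring, h2, div_div]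
  ring

theorem alphaStar_mul_le (n : ℕ) : alphaStar n * n ≤ 2 := by
  have h : ∑ k ∈ Finset.range (n + 1), (n.choose k : ℝ) * (1 / k) ≤
      2 / (n + 1) * 2 ^ (n + 1) := by
    calc ∑ k ∈ Finset.range (n + 1), (n.choose k : ℝ) * (1 / k)
        ≤ ∑ k ∈ Finset.range (n + 1), 2 / ((n : ℝ) + 1) * ((n + 1).choose (k + 1) : ℝ) := by
          refine Finset.sum_le_sum fun k _ => ?_
          have h1 : (1 : ℝ) / k ≤ 2 / (k + 1) := by
            rcases k.eq_zero_or_pos with rfl | hk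
            · simp
            · have : (1 : ℝ) ≤ k := by exact_mod_cast hk
              rw [div_le_div_iff₀ (by positivity) (by positivity)]
              linarith
          calc (n.choose k : ℝ) * (1 / k) ≤ n.choose k * (2 / (k + 1)) := by gcongr
            _ = 2 * (n.choose k / (k + 1)) := by ring
            _ = _ := by rw [choose_div_succ]; ring
      _ ≤ 2 / (n + 1) * 2 ^ (n + 1) := by
          rw [← Finset.mul_sum]
          gcongr
          have := Nat.sum_range_choose (n + 1)
          rw [Finset.sum_range_succ'] at this
          have h2 : ∑ k ∈ Finset.range (n + 1), (n + 1).choose (k + 1) ≤ 2 ^ (n + 1) := by omega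
          exact_mod_cast h2
  rw [alphaStar_eq, pow_succ] at h
  have h3 : (2 : ℝ) ^ n * (alphaStar n * (n + 1)) ≤ 2 ^ n * 2 := by
    have : (2 : ℝ) / (n + 1) * (2 ^ n * 2) = (2 ^ n * 4) / (n + 1) := by ring
    rw [this, le_div_iff₀ (by positivity)] at h
    linarith
  have h4 := le_of_mul_le_mul_left h3 (by positivity)
  rcases n.eq_zero_or_pos with rfl | hn
  · simp
  · have := alphaStar_pos hn
    nlinarith

theorem sum_range_add_three_le (n : ℕ) {f : ℕ → ℝ} (hf : ∀ i, 0 ≤ f i) :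
    ∑ i ∈ Finset.range n, f (i + 1 + 2) ≤ ∑ i ∈ Finset.range (n + 2 + 1), f i := by
  rw [Finset.sum_range_succ', Finset.sum_range_succ', Finset.sum_range_succ']
  have := hf 0
  have := hf (0 + 1)
  have := hf (0 + 1 + 1)
  linarith

theorem sum_choose_mul_half_div_sub_one_sq_le {n : ℕ} (hn : 1 ≤ n) :
    (∑ k ∈ Finset.range (n + 1), (n.choose k : ℝ) * ((n : ℝ) / 2 / (k : ℝ) - 1) ^ 2) / (2 : ℝ) ^ n ≤
      19 / (n : ℝ) := by
  have hn' : (1 : ℝ) ≤ n := by exact_mod_cast hn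
  have hterm : ∀ k : ℕ, 1 ≤ k → (n.choose k : ℝ) * ((n : ℝ) / 2 / k - 1) ^ 2 ≤
      6 / ((n + 1) * (n + 2)) *
        (((n + 2).choose (k + 2) : ℝ) * (((k + 2 : ℕ) : ℝ) - ((n + 2 : ℕ) : ℝ) / 2 - 1) ^ 2) := by
    intro k hk
    have hk' : (1 : ℝ) ≤ k := by exact_mod_cast hk
    have h1 : ((n : ℝ) / 2 / k - 1) ^ 2 ≤ 6 * (k - n / 2) ^ 2 / ((k + 1) * (k + 2)) := by
      have : ((n : ℝ) / 2 / k - 1) ^ 2 = (k - n / 2) ^ 2 * (1 / k ^ 2) := by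
        field_simp
        ring
      -- The 6 is the value of `(k+1)(k+2)/k²` at `k = 1`, where it is largest.
      have h2 : (1 : ℝ) / k ^ 2 ≤ 6 / ((k + 1) * (k + 2)) := by
        rw [div_le_div_iff₀ (by positivity) (by positivity)]
        nlinarith
      rw [this]
      calc _ ≤ (k - (n : ℝ) / 2) ^ 2 * (6 / ((k + 1) * (k + 2))) := by gcongr
        _ = _ := by ring
    calc (n.choose k : ℝ) * ((n : ℝ) / 2 / k - 1) ^ 2
        ≤ (n.choose k : ℝ) * (6 * ((k : ℝ) - n / 2) ^ 2 / ((k + 1) * (k + 2))) := by gcongr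
      _ = 6 * ((k : ℝ) - n / 2) ^ 2 * ((n.choose k : ℝ) / ((k + 1) * (k + 2))) := by ring
      _ = _ := by
          rw [choose_div_succ_mul_succ]
          push_cast
          ring
  have hsum : ∑ k ∈ Finset.range (n + 1), (n.choose k : ℝ) * ((n : ℝ) / 2 / k - 1) ^ 2 ≤
      1 + 6 / ((n + 1) * (n + 2)) * (2 ^ (n + 2) * (((n + 2 : ℕ) : ℝ) / 4 + 1 ^ 2)) := by
    -- The term `k = 0` equals 1, since division by zero gives 0; it is the component of `|w⟩` along
    -- the uniform state.
    rw [Finset.sum_range_succ', add_comm]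
    have hm := sum_choose_mul_sq (n + 2) 1
    rw [← hm]
    refine add_le_add (by simp) ?_
    calc _ ≤ ∑ k ∈ Finset.range n, 6 / (((n : ℝ) + 1) * (n + 2)) *
          (((n + 2).choose (k + 1 + 2) : ℝ) *
            (((k + 1 + 2 : ℕ) : ℝ) - ((n + 2 : ℕ) : ℝ) / 2 - 1) ^ 2) :=
          Finset.sum_le_sum fun k _ => hterm (k + 1) (by omega)
      _ ≤ _ := by
          rw [← Finset.mul_sum]
          gcongr
          exact sum_range_add_three_le n (f := fun i => ((n + 2).choose i : ℝ) *
            ((i : ℝ) - ((n + 2 : ℕ) : ℝ) / 2 - 1) ^ 2) fun i => by positivity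
  have h1 : (1 : ℝ) / 2 ^ n ≤ 1 / n := by
    apply one_div_le_one_div_of_le (by positivity)
    exact_mod_cast n.lt_two_pow_self.le
  calc _ ≤ (1 + 6 / (((n : ℝ) + 1) * (n + 2)) *
        (2 ^ (n + 2) * (((n + 2 : ℕ) : ℝ) / 4 + 1 ^ 2))) / 2 ^ n := by gcongr
    _ = 1 / 2 ^ n + 6 * (n + 6) / ((n + 1) * (n + 2)) := by
        push_cast
        field_simp
        ring
    _ ≤ 1 / n + 18 / n := by
        refine add_le_add h1 ?_
        rw [div_le_div_iff₀ (by positivity) (by positivity)]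
        nlinarith
    _ = 19 / n := by ring

/-- The squared distance between the marked state and its approximation in the invariant plane. -/
theorem sum_choose_mul_alphaStar_sq_le {n : ℕ} (hn : 38 ≤ n) :
    (∑ k ∈ Finset.range (n + 1), (n.choose k : ℝ) * (1 / (2 * alphaStar n) / (k : ℝ) - 1) ^ 2) /
      (2 : ℝ) ^ n ≤ 38 / (n : ℝ) := by
  have hn1 : 1 ≤ n := by omega
  have hα := alphaStar_pos hn1
  have hF := sum_choose_mul_half_div_sub_one_sq_le hn1
  have hn' : (38 : ℝ) ≤ n := by exact_mod_cast hn
  set a : ℝ := 1 / (2 * alphaStar n) with ha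
  have ha0 : 0 < a := by positivity
  set G : ℝ := (∑ k ∈ Finset.range (n + 1), (n.choose k : ℝ) * (a / k) ^ 2) / 2 ^ n with hG
  have hchoose : ∑ k ∈ Finset.range (n + 1), (n.choose k : ℝ) = 2 ^ n := by
    exact_mod_cast Nat.sum_range_choose n
  -- The variable `a / k` has mean 1 and second moment `G`, so `x = 1` gives `G - 1`, while `x = n /
  -- (2a)` gives the quantity bounded by `19 / n`.
  have expand : ∀ x : ℝ,
      (∑ k ∈ Finset.range (n + 1), (n.choose k : ℝ) * (x * a / k - 1) ^ 2) / 2 ^ n =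
        x ^ 2 * G - 2 * x + 1 := by
    intro x
    have h1 : ∀ k : ℕ, (n.choose k : ℝ) * (x * a / k - 1) ^ 2 =
        x ^ 2 * ((n.choose k : ℝ) * (a / k) ^ 2) - 2 * x * a * ((n.choose k : ℝ) * (1 / k)) +
          n.choose k := fun k => by ring
    simp only [h1]
    rw [Finset.sum_add_distrib, Finset.sum_sub_distrib, ← Finset.mul_sum, ← Finset.mul_sum,
      alphaStar_eq, hchoose, hG, ha]
    field_simp
  have h1 := expand 1
  have h2 := expand ((n : ℝ) / 2 / a)
  rw [one_mul] at h1
  rw [div_mul_cancel₀ _ ha0.ne'] at h2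
  rw [h2] at hF
  rw [h1]
  set x := (n : ℝ) / 2 / a
  have hhalf : (19 : ℝ) / n ≤ 1 / 2 := by
    rw [div_le_div_iff₀ (by positivity) (by norm_num)]
    linarith
  have hG0 : 0 ≤ G := by positivity
  -- The quadratic `x² G - 2x + 1` is at least its minimum `1 - 1/G`. As `n ≥ 38` makes `19/n ≤
  -- 1/2`, this forces `G ≤ 2`.
  have key : G - 1 ≤ G * (19 / n) := by
    have := mul_le_mul_of_nonneg_left hF hG0
    nlinarith [sq_nonneg (x * G - 1)]
  have hG2 : G ≤ 2 := by nlinarith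
  have h38 : (38 : ℝ) / n = 2 * (19 / n) := by ring
  have : G * (19 / n) ≤ 2 * (19 / n) := by gcongr
  rw [h38]
  linarith

end Binomial

/-! ### Diagonalization of `Hx` by Walsh functions. -/

section Walsh

variable {n : ℕ}

/-- The Walsh functions, which diagonalize `Hx n`. -/
def walsh (S : Finset (Fin n)) (x : Fin n → Bool) : ℝ := ∏ j ∈ S, if x j then -1 else 1

theorem walsh_sq (S : Finset (Fin n)) (x : Fin n → Bool) : walsh S x ^ 2 = 1 := by
  rw [walsh, ← Finset.prod_pow]
  refine Finset.prod_eq_one fun j _ => ?_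
  split_ifs <;> norm_num

theorem walsh_empty (x : Fin n → Bool) : walsh ∅ x = 1 := by simp [walsh]

/-- The sum over subsets expands a product of factors `1 + a_j`, and the factor at a bit where `x`
and `w` differ is 0. -/
theorem sum_walsh_mul_walsh (w x : Fin n → Bool) :
    ∑ S : Finset (Fin n), walsh S w * walsh S x = if x = w then 2 ^ n else 0 := by
  have h : ∀ S : Finset (Fin n), walsh S w * walsh S x =
      ∏ j ∈ S, ((if w j then -1 else 1) * (if x j then -1 else 1) : ℝ) := fun S => by
    rw [walsh, walsh, Finset.prod_mul_distrib]
  simp only [h]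
  rw [← Finset.powerset_univ, ← Finset.prod_one_add]
  split_ifs with hx
  · subst hx
    have : ∀ j, (1 + (if x j then -1 else 1) * (if x j then -1 else 1) : ℝ) = 2 := fun j => by
      split_ifs <;> norm_num
    simp only [this]
    simp
  · obtain ⟨j, hj⟩ := Function.ne_iff.1 hx
    refine Finset.prod_eq_zero (Finset.mem_univ j) ?_
    cases hxj : x j <;> cases hwj : w j <;> simp_all

theorem sum_walsh_orthogonal (S T : Finset (Fin n)) :
    ∑ x : Fin n → Bool, walsh S x * walsh T x = if S = T then 2 ^ n else 0 := by
  have h : ∀ x : Fin n → Bool, walsh S x * walsh T x =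
      ∏ j, ((if j ∈ S then (if x j then -1 else 1) else 1) *
        (if j ∈ T then (if x j then -1 else 1) else 1) : ℝ) := fun x => by
    rw [walsh, walsh, Finset.prod_mul_distrib, Finset.prod_ite_mem, Finset.prod_ite_mem,
      Finset.univ_inter, Finset.univ_inter]
  simp only [h]
  have h2 := Finset.prod_univ_sum (fun _ : Fin n => (Finset.univ : Finset Bool))
    (fun j b => ((if j ∈ S then (if b then -1 else 1) else 1) *
        (if j ∈ T then (if b then -1 else 1) else 1) : ℝ))
  rw [Fintype.piFinset_univ] at h2
  rw [← h2]
  split_ifs with hST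
  · subst hST
    have : ∀ j, ∑ b : Bool, ((if j ∈ S then (if b then -1 else 1) else 1) *
        (if j ∈ S then (if b then -1 else 1) else 1) : ℝ) = 2 := fun j => by
      split_ifs <;> norm_num
    simp only [this]
    simp
  · have : ∃ j, ¬ (j ∈ S ↔ j ∈ T) := by
      by_contra hc
      push Not at hc
      exact hST (Finset.ext hc)
    obtain ⟨j, hj⟩ := this
    refine Finset.prod_eq_zero (Finset.mem_univ j) ?_
    by_cases hS : j ∈ S <;> by_cases hT : j ∈ T <;> simp_all

theorem sum_sq_walsh_combination (c : Finset (Fin n) → ℝ) :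
    ∑ x : Fin n → Bool, (∑ S, c S * walsh S x) ^ 2 = 2 ^ n * ∑ S, c S ^ 2 := by
  have h : ∀ x : Fin n → Bool, (∑ S, c S * walsh S x) ^ 2 =
      ∑ S, ∑ T, c S * c T * (walsh S x * walsh T x) := fun x => by
    rw [pow_two, Finset.sum_mul_sum]
    refine Finset.sum_congr rfl fun S _ => Finset.sum_congr rfl fun T _ => ?_
    ring
  simp only [h]
  rw [Finset.sum_comm, Finset.mul_sum]
  refine Finset.sum_congr rfl fun S _ => ?_
  rw [Finset.sum_comm]
  simp only [← Finset.mul_sum, sum_walsh_orthogonal]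
  simp
  ring

theorem pauliX_mulVec (j : Fin n) (v : QVec n) (x : Fin n → Bool) :
    (pauliX j).mulVec v x = v (Function.update x j (!x j)) := by
  have h : ∀ y : Fin n → Bool, x = Function.update y j (!y j) ↔
      y = Function.update x j (!x j) := by
    intro y
    constructor <;> rintro rfl <;> simp
  simp only [Matrix.mulVec, dotProduct, pauliX, Matrix.of_apply, h]
  simp

theorem walsh_update (j : Fin n) (S : Finset (Fin n)) (x : Fin n → Bool) :
    walsh S (Function.update x j (!x j)) = (if j ∈ S then -1 else 1) * walsh S x := by
  unfold walsh
  split_ifs with h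
  · rw [← Finset.mul_prod_erase _ _ h, ← Finset.mul_prod_erase S _ h, ← mul_assoc]
    congr 1
    · cases hx : x j <;> simp
    · refine Finset.prod_congr rfl fun k hk => ?_
      rw [Function.update_of_ne (Finset.ne_of_mem_erase hk)]
  · rw [one_mul]
    refine Finset.prod_congr rfl fun k hk => ?_
    rw [Function.update_of_ne]
    rintro rfl
    exact h hk

/-- A Walsh function as a state vector. -/
def walshVec (S : Finset (Fin n)) : QVec n := fun x => (walsh S x : ℂ)

theorem Hx_mulVec_walshVec (S : Finset (Fin n)) :
    (Hx n).mulVec (walshVec S) = ((n : ℂ) - 2 * S.card) • walshVec S := by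
  ext x
  have h : (Hx n).mulVec (walshVec S) x = ∑ j, (pauliX j).mulVec (walshVec S) x := by
    rw [Hx, Matrix.sum_mulVec, Finset.sum_apply]
  have h2 : ∑ j : Fin n, (if j ∈ S then (-1 : ℝ) else 1) = n - 2 * S.card := by
    have : ∀ j : Fin n, (if j ∈ S then (-1 : ℝ) else 1) = 1 - 2 * (if j ∈ S then 1 else 0) := by
      intro j
      split_ifs <;> norm_num
    simp only [this]
    rw [Finset.sum_sub_distrib, ← Finset.mul_sum]
    simp
  rw [h]
  simp only [pauliX_mulVec, walshVec, walsh_update, Complex.ofReal_mul, Pi.smul_apply, smul_eq_mul]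
  rw [← Finset.sum_mul, ← Complex.ofReal_sum, h2]
  push_cast
  ring

theorem Hw_mulVec (w : Fin n → Bool) (v : QVec n) : (Hw w).mulVec v = v w • ket w := by
  ext x
  rw [Hw, Matrix.vecMulVec_mulVec]
  have : star (ket w) ⬝ᵥ v = v w := by
    simp [ket, single_dotProduct]
  rw [this]
  simp [mul_comm]

theorem ket_eq_walsh (w : Fin n → Bool) :
    ket w = ∑ S, ((walsh S w / 2 ^ n : ℝ) : ℂ) • walshVec S := by
  ext x
  have h := sum_walsh_mul_walsh w x
  rw [Finset.sum_apply]
  simp only [Pi.smul_apply, smul_eq_mul, walshVec, ← Complex.ofReal_mul]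
  rw [← Complex.ofReal_sum]
  have : ∑ S, walsh S w / 2 ^ n * walsh S x = (∑ S, walsh S w * walsh S x) / 2 ^ n := by
    rw [Finset.sum_div]
    exact Finset.sum_congr rfl fun S _ => by ring
  rw [this, h, ket, Pi.single_apply]
  split_ifs <;> simp

end Walsh

/-! ### Approximate solutions of the Schrödinger equation. -/

section Duhamel

variable {E : Type*} [NormedAddCommGroup E] [InnerProductSpace ℂ E] [CompleteSpace E]

theorem exp_I_smul_mem_unitary {A : Type*} [NormedRing A] [NormedAlgebra ℂ A] [CompleteSpace A]
    [StarRing A] [ContinuousStar A] [StarModule ℂ A] {B : A} (hB : IsSelfAdjoint B) (t : ℝ) :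
    NormedSpace.exp ((Complex.I * t) • B) ∈ unitary A := by
  let _ : NormedAlgebra ℚ A := NormedAlgebra.restrictScalars ℚ ℂ A
  apply NormedSpace.exp_mem_unitary_of_mem_skewAdjoint
  apply hB.smul_mem_skewAdjoint
  simp [skewAdjoint.mem_iff]

/-- In the interaction picture `exp(itB) ψ(t)` the derivative is the defect of `ψ` moved by a
unitary, so its norm stays at most `δ`. -/
theorem norm_exp_apply_sub_le {B : E →L[ℂ] E} (hB : IsSelfAdjoint B) {ψ ψ' : ℝ → E}
    (hψ : ∀ t, HasDerivAt ψ (ψ' t) t) {δ : ℝ} (hδ : ∀ t, ‖ψ' t + Complex.I • B (ψ t)‖ ≤ δ)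
    {T : ℝ} (hT : 0 ≤ T) :
    ‖NormedSpace.exp ((-Complex.I * T) • B) (ψ 0) - ψ T‖ ≤ δ * T := by
  have hder : ∀ t : ℝ, HasDerivAt (fun t : ℝ => NormedSpace.exp ((Complex.I * t) • B) (ψ t))
      (NormedSpace.exp ((Complex.I * t) • B) (ψ' t + Complex.I • B (ψ t))) t := by
    intro t
    have h1 : HasDerivAt (fun t : ℝ => NormedSpace.exp ((Complex.I * t) • B))
        (NormedSpace.exp ((Complex.I * t) • B) * (Complex.I • B)) t := by
      have h := hasDerivAt_exp_smul_const (𝕂 := ℝ) (Complex.I • B) t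
      have e : ∀ s : ℝ, s • Complex.I • B = (Complex.I * s) • B := fun s => by
        rw [mul_comm, mul_smul, Complex.coe_smul]
      simpa only [e] using h
    have h2 := (ContinuousLinearMap.restrictScalarsL ℂ E E ℝ ℝ).hasFDerivAt.comp_hasDerivAt t h1
    have h3 := HasDerivAt.clm_apply h2 (hψ t)
    refine h3.congr_deriv ?_
    simp [map_add, add_comm]
  have h := norm_image_sub_le_of_norm_deriv_le_segment'
    (fun t (_ : t ∈ Set.Icc 0 T) => (hder t).hasDerivWithinAt) (C := δ)
    (fun t _ => by
      rw [ContinuousLinearMap.norm_map_of_mem_unitary (exp_I_smul_mem_unitary hB t)]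
      exact hδ t) T ⟨hT, le_rfl⟩
  have hU : NormedSpace.exp ((Complex.I * T) • B) *
      NormedSpace.exp ((-Complex.I * T) • B) = 1 := by
    rw [exp_smul_mul_exp_smul]
    simp
  have hx : NormedSpace.exp ((Complex.I * T) • B)
      (NormedSpace.exp ((-Complex.I * T) • B) (ψ 0) - ψ T) =
      ψ 0 - NormedSpace.exp ((Complex.I * T) • B) (ψ T) := by
    rw [map_sub, ← mul_apply_eq_comp, hU, one_apply_eq_self]
  rw [← ContinuousLinearMap.norm_map_of_mem_unitary (exp_I_smul_mem_unitary hB T), hx,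
    norm_sub_rev]
  simpa using h

end Duhamel

section L2Operator

open scoped Matrix.Norms.L2Operator

/-! ### The continuous-time walk near its almost invariant plane. -/

section Walk

variable {n : ℕ}

theorem toEuclideanCLM_exp (M : QOp n) :
    Matrix.toEuclideanCLM (𝕜 := ℂ) (NormedSpace.exp M) =
      NormedSpace.exp (Matrix.toEuclideanCLM (𝕜 := ℂ) M) := by
  let _ : NormedAlgebra ℚ (QOp n) := NormedAlgebra.restrictScalars ℚ ℂ (QOp n)
  let _ : Algebra ℚ (EuclideanSpace ℂ (Fin n → Bool) →L[ℂ] EuclideanSpace ℂ (Fin n → Bool)) :=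
    Algebra.compHom _ (algebraMap ℚ ℂ)
  have hc : Continuous (Matrix.toEuclideanCLM (𝕜 := ℂ) (n := Fin n → Bool)) :=
    LinearMap.continuous_of_finiteDimensional
      { toFun := Matrix.toEuclideanCLM (𝕜 := ℂ) (n := Fin n → Bool)
        map_add' := map_add _
        map_smul' := map_smul _ }
  exact NormedSpace.map_exp (Matrix.toEuclideanCLM (𝕜 := ℂ) (n := Fin n → Bool)) hc M

theorem exp_mulVec_of_eigenvector {M : QOp n} {v : QVec n} {μ : ℂ} (h : M.mulVec v = μ • v) :
    (NormedSpace.exp M).mulVec v = Complex.exp μ • v := by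
  have hp : ∀ k : ℕ, (M ^ k).mulVec v = μ ^ k • v := by
    intro k
    induction k with
    | zero => simp
    | succ k ih => rw [pow_succ, ← Matrix.mulVec_mulVec, h, Matrix.mulVec_smul, ih, smul_smul,
        pow_succ, mul_comm]
  let f : QOp n →ₗ[ℂ] QVec n := (Matrix.mulVecBilin ℂ ℂ).flip v
  have h1 := (NormedSpace.exp_series_hasSum_exp' (𝕂 := ℂ) M).map f
    (LinearMap.continuous_of_finiteDimensional f)
  have h2 := (NormedSpace.expSeries_div_hasSum_exp (𝔸 := ℂ) μ).smul_const v
  rw [← Complex.exp_eq_exp_ℂ] at h2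
  refine h1.unique (h2.congr_fun ?_)
  intro k
  simp [f, hp, div_eq_inv_mul, smul_smul]

theorem pauliX_symm (j : Fin n) (x y : Fin n → Bool) : pauliX j x y = pauliX j y x := by
  have h : x = Function.update y j (!y j) ↔ y = Function.update x j (!x j) := by
    constructor <;> rintro rfl <;> simp
  simp [pauliX, h]

theorem isSelfAdjoint_pauliX (j : Fin n) : IsSelfAdjoint (pauliX j) := by
  ext x y
  rw [Matrix.star_apply, pauliX_symm]
  simp [pauliX, apply_ite]

theorem isSelfAdjoint_Hx : IsSelfAdjoint (Hx n) :=
  isSelfAdjoint_sum _ fun j _ => isSelfAdjoint_pauliX j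

theorem isSelfAdjoint_Hw (w : Fin n → Bool) : IsSelfAdjoint (Hw w) := by
  ext x y
  simp [Hw, Matrix.vecMulVec, mul_comm]

theorem ext_mulVec_ket {M N : QOp n} (h : ∀ w, M.mulVec (ket w) = N.mulVec (ket w)) : M = N := by
  ext x y
  have := congrFun (h y) x
  simpa [ket] using this

theorem norm_pauliX_le (j : Fin n) : ‖pauliX j‖ ≤ 1 := by
  have h : pauliX j * pauliX j = 1 := by
    refine ext_mulVec_ket fun w => ?_
    ext x
    rw [← Matrix.mulVec_mulVec, pauliX_mulVec, pauliX_mulVec]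
    simp
  have h2 := CStarRing.norm_star_mul_self (x := pauliX j)
  rw [(isSelfAdjoint_pauliX j).star_eq, h, norm_one] at h2
  nlinarith [norm_nonneg (pauliX j)]

theorem norm_Hx_le : ‖Hx n‖ ≤ n :=
  (norm_sum_le_of_le _ fun j _ => norm_pauliX_le j).trans (by simp)

theorem norm_Hw_le (w : Fin n → Bool) : ‖Hw w‖ ≤ 1 := by
  have h : Hw w * Hw w = Hw w := by
    refine ext_mulVec_ket fun y => ?_
    rw [← Matrix.mulVec_mulVec, Hw_mulVec w (ket y), Matrix.mulVec_smul, Hw_mulVec]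
    simp [ket]
  have h2 := CStarRing.norm_star_mul_self (x := Hw w)
  rw [(isSelfAdjoint_Hw w).star_eq, h] at h2
  nlinarith [norm_nonneg (Hw w)]

/-- The overlap `⟨w|+⟩ = 2 ^ (-n / 2)`. -/
noncomputable def epsilon (n : ℕ) : ℝ := (1 / √2) ^ n

theorem epsilon_pos : 0 < epsilon n := by unfold epsilon; positivity

theorem epsilon_sq : epsilon n * epsilon n = 1 / 2 ^ n := by
  rw [epsilon, ← mul_pow, div_mul_div_comm, Real.mul_self_sqrt (by norm_num)]
  simp

theorem epsilon_mul_tStar : epsilon n * tStar n = Real.pi / 2 := by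
  have : √((2 : ℝ) ^ n) = √2 ^ n := by
    rw [Real.sqrt_eq_iff_mul_self_eq (by positivity) (by positivity), ← mul_pow,
      Real.mul_self_sqrt (by norm_num)]
  rw [epsilon, tStar, this, div_pow, one_pow]
  field_simp

theorem plusState_eq : plusState n = (epsilon n : ℂ) • walshVec ∅ := by
  ext x
  simp [plusState, walshVec, walsh_empty, epsilon]

theorem Hx_mulVec_plusState : (Hx n).mulVec (plusState n) = (n : ℂ) • plusState n := by
  rw [plusState_eq, Matrix.mulVec_smul, Hx_mulVec_walshVec, smul_comm]
  simp

/-- The state `∑_{k ≥ 1} (2 α* k)⁻¹ Pₖ |w⟩`, where `Pₖ` projects onto the eigenspace of `Hx n` for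
the eigenvalue `n - 2 k`. Together with the uniform superposition it spans a plane that is almost
invariant under the walk. -/
noncomputable def markedApprox (w : Fin n → Bool) : QVec n :=
  ∑ S : Finset (Fin n),
    ((walsh S w / 2 ^ n * (1 / (2 * alphaStar n) / S.card) : ℝ) : ℂ) • walshVec S

theorem markedApprox_apply (w x : Fin n → Bool) :
    markedApprox w x = ((∑ S : Finset (Fin n),
      walsh S w / 2 ^ n * (1 / (2 * alphaStar n) / S.card) * walsh S x : ℝ) : ℂ) := by
  simp [markedApprox, walshVec, Finset.sum_apply]

/-- This is what singles out `alphaStar`: the weight of `|w⟩` in level `k` is `choose n k / 2^n`,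
and `2 α*` is the mean of `1/k`. -/
theorem markedApprox_apply_self (hn : 1 ≤ n) (w : Fin n → Bool) : markedApprox w w = 1 := by
  have hα := alphaStar_pos hn
  rw [markedApprox_apply]
  have h : ∀ S : Finset (Fin n),
      walsh S w / 2 ^ n * (1 / (2 * alphaStar n) / S.card) * walsh S w =
        1 / (2 ^ n * (2 * alphaStar n)) * (1 / S.card) := fun S => by
    calc _ = walsh S w ^ 2 / 2 ^ n * (1 / (2 * alphaStar n) / S.card) := by ring
      _ = _ := by rw [walsh_sq]; ring
  simp only [h]
  rw [← Finset.mul_sum, sum_choose_mul_eq_sum_finset n (fun k => 1 / (k : ℝ)), alphaStar_eq]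
  have : 1 / (2 ^ n * (2 * alphaStar n)) * (2 ^ n * (2 * alphaStar n)) = 1 := by
    field_simp
  rw [this]
  simp

/-- On level `k ≥ 1` the factor `-2 α* k` cancels the coefficient of `markedApprox`, leaving `-|w⟩`
without its level 0 part. The term `-|w⟩` later cancels against `Hw`. -/
theorem alphaStar_Hx_mulVec_markedApprox (hn : 1 ≤ n) (w : Fin n → Bool) :
    (alphaStar n : ℂ) • (Hx n).mulVec (markedApprox w) =
      ((alphaStar n : ℂ) * n) • markedApprox w - ket w + (epsilon n : ℂ) • plusState n := by
  have hα := alphaStar_pos hn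
  have h0 : (epsilon n : ℂ) • plusState n =
      ∑ S : Finset (Fin n), (if S = ∅ then ((walsh S w / 2 ^ n : ℝ) : ℂ) else 0) • walshVec S := by
    rw [plusState_eq, smul_smul, ← Complex.ofReal_mul, epsilon_sq]
    simp [walsh_empty]
  rw [h0, ket_eq_walsh, markedApprox, Matrix.mulVec_sum, Finset.smul_sum, Finset.smul_sum,
    ← Finset.sum_sub_distrib, ← Finset.sum_add_distrib]
  refine Finset.sum_congr rfl fun S _ => ?_
  rw [Matrix.mulVec_smul, Hx_mulVec_walshVec, smul_smul, smul_smul, smul_smul, ← sub_smul,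
    ← add_smul]
  congr 1
  have hα' : (alphaStar n : ℂ) ≠ 0 := by exact_mod_cast hα.ne'
  split_ifs with hS
  · subst hS
    simp
  · have : (S.card : ℂ) ≠ 0 := by simpa using hS
    push_cast
    field_simp
    ring

theorem norm_markedApprox_sub_ket_le (hn : 38 ≤ n) (w : Fin n → Bool) :
    ‖WithLp.toLp 2 (markedApprox w) - WithLp.toLp 2 (ket w)‖ ≤ √(38 / n) := by
  have h : ∀ x, (markedApprox w - ket w) x = ((∑ S : Finset (Fin n),
      walsh S w / 2 ^ n * (1 / (2 * alphaStar n) / S.card - 1) * walsh S x : ℝ) : ℂ) := by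
    intro x
    rw [Pi.sub_apply, markedApprox_apply, ket_eq_walsh, Finset.sum_apply]
    simp only [Pi.smul_apply, smul_eq_mul, walshVec, ← Complex.ofReal_mul]
    rw [← Complex.ofReal_sum, ← Complex.ofReal_sub, ← Finset.sum_sub_distrib]
    congr 1
    exact Finset.sum_congr rfl fun S _ => by ring
  rw [← WithLp.toLp_sub, EuclideanSpace.norm_eq]
  apply Real.sqrt_le_sqrt
  refine le_trans (le_of_eq ?_) (sum_choose_mul_alphaStar_sq_le hn)
  simp only [h, Complex.norm_real, Real.norm_eq_abs, sq_abs]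
  rw [sum_sq_walsh_combination,
    ← sum_choose_mul_eq_sum_finset n (fun k => (1 / (2 * alphaStar n) / (k : ℝ) - 1) ^ 2),
    Finset.mul_sum, Finset.sum_div]
  refine Finset.sum_congr rfl fun S _ => ?_
  calc _ = 2 ^ n * (walsh S w ^ 2 / (2 ^ n) ^ 2 * (1 / (2 * alphaStar n) / S.card - 1) ^ 2) := by
        ring
    _ = _ := by
        rw [walsh_sq]
        field_simp

/-- The generator of the quantum walk. -/
noncomputable def walkHamiltonian (w : Fin n → Bool) : QOp n := (alphaStar n : ℂ) • Hx n + Hw w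

theorem isSelfAdjoint_walkHamiltonian (w : Fin n → Bool) : IsSelfAdjoint (walkHamiltonian w) := by
  refine IsSelfAdjoint.add (IsSelfAdjoint.smul ?_ isSelfAdjoint_Hx) (isSelfAdjoint_Hw w)
  exact Complex.conj_ofReal _

theorem walkHamiltonian_mulVec_plusState (w : Fin n → Bool) :
    (walkHamiltonian w).mulVec (plusState n) =
      ((alphaStar n : ℂ) * n) • plusState n + (epsilon n : ℂ) • ket w := by
  have : plusState n w = (epsilon n : ℂ) := by simp [plusState, epsilon]
  rw [walkHamiltonian, Matrix.add_mulVec, Matrix.smul_mulVec, Hx_mulVec_plusState, Hw_mulVec,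
    smul_smul, this]

theorem walkHamiltonian_mulVec_markedApprox (hn : 1 ≤ n) (w : Fin n → Bool) :
    (walkHamiltonian w).mulVec (markedApprox w) =
      ((alphaStar n : ℂ) * n) • markedApprox w + (epsilon n : ℂ) • plusState n := by
  rw [walkHamiltonian, Matrix.add_mulVec, Matrix.smul_mulVec,
    alphaStar_Hx_mulVec_markedApprox hn, Hw_mulVec, markedApprox_apply_self hn]
  module

theorem exists_norm_walk_sub_le (hn : 38 ≤ n) (w : Fin n → Bool) :
    ∃ c : ℂ, ‖WithLp.toLp 2 ((evolve (walkHamiltonian w) (tStar n)).mulVec (plusState n)) -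
      c • WithLp.toLp 2 (ket w)‖ ≤ 3 * √(38 / n) := by
  set ε := epsilon n with hε
  have hε0 : 0 < ε := epsilon_pos
  set ω : ℂ := (alphaStar n : ℂ) * n with hω
  set B := Matrix.toEuclideanCLM (𝕜 := ℂ) (walkHamiltonian w) with hB
  have hBsa : IsSelfAdjoint B :=
    (isSelfAdjoint_walkHamiltonian w).map (Matrix.toEuclideanCLM (𝕜 := ℂ) (n := Fin n → Bool))
  set s : EuclideanSpace ℂ (Fin n → Bool) := WithLp.toLp 2 (plusState n) with hs
  set g : EuclideanSpace ℂ (Fin n → Bool) := WithLp.toLp 2 (markedApprox w) with hg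
  set k : EuclideanSpace ℂ (Fin n → Bool) := WithLp.toLp 2 (ket w) with hk
  have hBs : B s = ω • s + (ε : ℂ) • k := by
    rw [hB, hs, Matrix.toEuclideanCLM_toLp, walkHamiltonian_mulVec_plusState]
    rfl
  have hBg : B g = ω • g + (ε : ℂ) • s := by
    rw [hB, hg, Matrix.toEuclideanCLM_toLp, walkHamiltonian_mulVec_markedApprox (by omega)]
    rfl
  have hgk : ‖g - k‖ ≤ √(38 / n) := norm_markedApprox_sub_ket_le hn w
  set p : ℝ → ℂ := fun t => Complex.exp (-Complex.I * ω * t) with hp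
  have hpnorm : ∀ t, ‖p t‖ = 1 := by
    intro t
    have : -Complex.I * ω * t = ((-(alphaStar n * n * t) : ℝ) : ℂ) * Complex.I := by
      rw [hω]; push_cast; ring
    simp only [hp]
    rw [this, Complex.norm_exp_ofReal_mul_I]
  have hpd : ∀ t : ℝ, HasDerivAt p (p t * (-Complex.I * ω)) t := by
    intro t
    have h1 : HasDerivAt (fun z : ℂ => Complex.exp (-Complex.I * ω * z))
        (Complex.exp (-Complex.I * ω * t) * (-Complex.I * ω)) (t : ℂ) := by
      simpa using ((hasDerivAt_id (t : ℂ)).const_mul (-Complex.I * ω)).cexp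
    exact h1.comp_ofReal
  have hcos : ∀ t : ℝ, HasDerivAt (fun t : ℝ => ((Real.cos (ε * t) : ℝ) : ℂ))
      ((-Real.sin (ε * t) * ε : ℝ) : ℂ) t := by
    intro t
    have h1 : HasDerivAt (fun t : ℝ => Real.cos (ε * t)) (-Real.sin (ε * t) * ε) t := by
      simpa using ((hasDerivAt_id t).const_mul ε).cos
    exact h1.ofReal_comp
  have hsin : ∀ t : ℝ, HasDerivAt (fun t : ℝ => ((Real.sin (ε * t) : ℝ) : ℂ))
      ((Real.cos (ε * t) * ε : ℝ) : ℂ) t := by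
    intro t
    have h1 : HasDerivAt (fun t : ℝ => Real.sin (ε * t)) (Real.cos (ε * t) * ε) t := by
      simpa using ((hasDerivAt_id t).const_mul ε).sin
    exact h1.ofReal_comp
  -- The exact solution if `g` and `k` coincided. Its only defect is that `B` sends `s` to `ε k`
  -- instead of `ε g`.
  set ψ : ℝ → EuclideanSpace ℂ (Fin n → Bool) := fun t =>
    (p t * (Real.cos (ε * t) : ℝ)) • s + (-Complex.I * (p t * (Real.sin (ε * t) : ℝ))) • g with hψ
  have hψd : ∀ t, HasDerivAt ψ
      ((p t * (-Complex.I * ω) * (Real.cos (ε * t) : ℝ) +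
          p t * ((-Real.sin (ε * t) * ε : ℝ) : ℂ)) • s +
        (-Complex.I * (p t * (-Complex.I * ω) * (Real.sin (ε * t) : ℝ) +
          p t * ((Real.cos (ε * t) * ε : ℝ) : ℂ))) • g) t := fun t =>
    (((hpd t).mul (hcos t)).smul_const s).add
      ((((hpd t).mul (hsin t)).const_mul (-Complex.I)).smul_const g)
  have hτ : 0 ≤ tStar n := by unfold tStar; positivity
  have hmain := norm_exp_apply_sub_le hBsa hψd (δ := ε * √(38 / n)) (fun t => ?_) hτ
  · have hψ0 : ψ 0 = s := by simp [hψ, hp]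
    have hψτ : ψ (tStar n) = (-Complex.I * p (tStar n)) • g := by
      simp only [hψ]
      rw [hε, epsilon_mul_tStar, Real.cos_pi_div_two, Real.sin_pi_div_two]
      simp
    have hev : WithLp.toLp 2 ((evolve (walkHamiltonian w) (tStar n)).mulVec (plusState n)) =
        NormedSpace.exp ((-Complex.I * (tStar n : ℂ)) • B) s := by
      rw [hB, ← map_smul, ← toEuclideanCLM_exp, hs, Matrix.toEuclideanCLM_toLp, evolve]
    refine ⟨-Complex.I * p (tStar n), ?_⟩
    rw [hψ0, hψτ, ← hev, mul_right_comm, hε, epsilon_mul_tStar] at hmain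
    have h2 : ‖(-Complex.I * p (tStar n)) • g - (-Complex.I * p (tStar n)) • k‖ ≤ √(38 / n) := by
      rw [← smul_sub, norm_smul, norm_mul, hpnorm]
      simpa using hgk
    have h3 := norm_sub_le_norm_sub_add_norm_sub
      (WithLp.toLp 2 ((evolve (walkHamiltonian w) (tStar n)).mulVec (plusState n)))
      ((-Complex.I * p (tStar n)) • g) ((-Complex.I * p (tStar n)) • k)
    -- The accumulated defect costs `π/2 ≤ 2`, and replacing `g` by `k` costs 1 more, hence the
    -- factor 3.
    have h4 : Real.pi / 2 * √(38 / n) ≤ 2 * √(38 / n) := by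
      gcongr
      linarith [Real.pi_le_four]
    linarith
  · have e : (p t * (-Complex.I * ω) * (Real.cos (ε * t) : ℝ) +
          p t * ((-Real.sin (ε * t) * ε : ℝ) : ℂ)) • s +
        (-Complex.I * (p t * (-Complex.I * ω) * (Real.sin (ε * t) : ℝ) +
          p t * ((Real.cos (ε * t) * ε : ℝ) : ℂ))) • g + Complex.I • B (ψ t) =
        (-Complex.I * p t * (Real.cos (ε * t) : ℝ) * ε) • (g - k) := by
      simp only [hψ, map_add, map_smul, hBs, hBg]
      have hI := Complex.I_mul_I
      push_cast
      match_scalars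
      · linear_combination (-(p t * Complex.sin (ε * t) * ε)) * hI
      · ring
      · ring
    rw [e, norm_smul, norm_mul, norm_mul, norm_mul, hpnorm, Complex.norm_real, Complex.norm_real,
      norm_neg, Complex.norm_I, one_mul, one_mul, Real.norm_eq_abs, Real.norm_eq_abs,
      abs_of_pos hε0]
    have := Real.abs_cos_le_one (ε * t)
    calc |Real.cos (ε * t)| * ε * ‖g - k‖ ≤ 1 * ε * √(38 / n) := by gcongr
      _ = _ := by ring

/-- The mass of a unit vector off the coordinate `w` is at most its squared distance to any multiple
of `|w⟩`; hence the gain from `δ` to `δ²`. -/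
theorem abs_overlap_sub_one_le {w : Fin n → Bool} {φ : QVec n} (hφ : ‖WithLp.toLp 2 φ‖ = 1)
    {c : ℂ} {δ : ℝ} (h : ‖WithLp.toLp 2 φ - c • WithLp.toLp 2 (ket w)‖ ≤ δ) :
    |overlap w φ - 1| ≤ δ ^ 2 := by
  have ho : overlap w φ = ‖φ w‖ ^ 2 := by
    simp [overlap, ket, single_dotProduct]
  rw [EuclideanSpace.norm_eq, Real.sqrt_eq_one] at hφ
  have h2 : ‖WithLp.toLp 2 (φ - c • ket w)‖ ^ 2 ≤ δ ^ 2 := by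
    gcongr
    exact h
  rw [EuclideanSpace.norm_sq_eq] at h2
  rw [← Finset.add_sum_erase _ _ (Finset.mem_univ w)] at hφ h2
  have h3 : ∀ x ∈ Finset.univ.erase w, ‖(φ - c • ket w) x‖ ^ 2 = ‖φ x‖ ^ 2 := by
    intro x hx
    simp [ket, Finset.ne_of_mem_erase hx]
  rw [Finset.sum_congr rfl h3] at h2
  have h4 : 0 ≤ ‖(φ - c • ket w) w‖ ^ 2 := by positivity
  have h5 : 0 ≤ ∑ x ∈ Finset.univ.erase w, ‖φ x‖ ^ 2 := by positivity
  rw [ho, abs_le]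
  constructor <;> linarith

theorem overlap_le_one {w : Fin n → Bool} {φ : QVec n} (hφ : ‖WithLp.toLp 2 φ‖ = 1) :
    |overlap w φ - 1| ≤ 1 := by
  simpa using abs_overlap_sub_one_le (c := 0) (δ := 1) hφ (by simp [hφ])

theorem norm_plusState : ‖WithLp.toLp 2 (plusState n)‖ = 1 := by
  rw [EuclideanSpace.norm_eq, Real.sqrt_eq_one]
  have h : ∀ x : Fin n → Bool, ‖(WithLp.toLp 2 (plusState n)) x‖ ^ 2 = 1 / 2 ^ n := by
    intro x
    rw [← epsilon_sq]
    have : plusState n x = (epsilon n : ℂ) := by simp [plusState, epsilon]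
    simp [this, abs_of_pos epsilon_pos, pow_two]
  simp [h]

end Walk

/-! ### Discretization error of the walk. -/

section Trotter

variable {n : ℕ}

theorem suzuki_eq_suzukiC (H₁ H₂ : QOp n) (m : ℕ) (t : ℝ) :
    suzuki H₁ H₂ m t = suzukiC H₁ H₂ m (t : ℂ) := by
  induction m generalizing t with
  | zero => simp [suzuki, suzukiC]
  | succ m ih =>
    simp only [suzuki, suzukiC, ih]
    push_cast
    rfl

theorem evolve_mem_unitary {H : QOp n} (hH : IsSelfAdjoint H) (t : ℝ) :
    evolve H t ∈ unitary (QOp n) := by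
  have h : -Complex.I * (t : ℂ) = Complex.I * ((-t : ℝ) : ℂ) := by
    push_cast
    ring
  rw [evolve, h]
  exact exp_I_smul_mem_unitary hH (-t)

theorem evolve_add (H : QOp n) (s t : ℝ) : evolve H (s + t) = evolve H s * evolve H t := by
  rw [evolve, evolve, evolve, exp_smul_mul_exp_smul, Complex.ofReal_add, mul_add]

theorem evolve_zero (H : QOp n) : evolve H 0 = 1 := by simp [evolve]

/-- One Strang step of the walk. -/
noncomputable def strangStep (w : Fin n → Bool) (t : ℝ) : QOp n :=
  evolve (Hx n) (alphaStar n * t / 2) * evolve (Hw w) t * evolve (Hx n) (alphaStar n * t / 2)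

theorem strangStep_mem_unitary (w : Fin n → Bool) (t : ℝ) :
    strangStep w t ∈ unitary (QOp n) :=
  mul_mem (mul_mem (evolve_mem_unitary isSelfAdjoint_Hx _)
    (evolve_mem_unitary (isSelfAdjoint_Hw w) _)) (evolve_mem_unitary isSelfAdjoint_Hx _)

/-- The durations of the Strang steps that make up a Trotter–Suzuki step of duration `t`. -/
noncomputable def suzukiTimes : ℕ → ℝ → List ℝ
  | 0, t => [t]
  | m + 1, t =>
      suzukiTimes m (suzukiCoeff m * t) ++ suzukiTimes m (suzukiCoeff m * t) ++
        suzukiTimes m ((1 - 4 * suzukiCoeff m) * t) ++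
        (suzukiTimes m (suzukiCoeff m * t) ++ suzukiTimes m (suzukiCoeff m * t))

theorem length_suzukiTimes (m : ℕ) (t : ℝ) : (suzukiTimes m t).length = 5 ^ m := by
  induction m generalizing t with
  | zero => rfl
  | succ m ih =>
    simp only [suzukiTimes, List.length_append, ih]
    ring

theorem suzuki_walk_eq_prod (w : Fin n → Bool) (m : ℕ) (t : ℝ) :
    suzuki ((-Complex.I) • Hw w) ((-Complex.I * (alphaStar n : ℂ)) • Hx n) m t =
      ((suzukiTimes m t).map (strangStep w)).prod := by
  induction m generalizing t with
  | zero =>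
    have h1 : NormedSpace.exp (((t / 2 : ℝ) : ℂ) • (-Complex.I * (alphaStar n : ℂ)) • Hx n) =
        evolve (Hx n) (alphaStar n * t / 2) := by
      rw [evolve, smul_smul]
      congr 2
      push_cast
      ring
    have h2 : NormedSpace.exp (((t / 2 : ℝ) : ℂ) • (-Complex.I) • Hw w) =
        evolve (Hw w) (t / 2) := by
      rw [evolve, smul_smul]
      congr 2
      push_cast
      ring
    simp only [suzuki, suzukiTimes, h1, h2, List.map_cons, List.map_nil, List.prod_cons,
      List.prod_nil, mul_one, strangStep]
    rw [← add_halves t, evolve_add, add_halves]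
    simp only [mul_assoc]
  | succ m ih =>
    simp only [suzukiTimes, List.map_append, List.prod_append, ← ih, suzuki, pow_two]
    rfl

theorem trotterWalk_eq_prod (w : Fin n → Bool) (m r : ℕ) :
    trotterWalk w m r =
      ((List.replicate r (suzukiTimes m (tStar n / r))).flatten.map (strangStep w)).prod := by
  rw [trotterWalk, suzuki_walk_eq_prod]
  induction r with
  | zero => simp
  | succ r _ => simp [List.map_flatten, List.prod_flatten]

theorem trotterWalk_mem_unitary (w : Fin n → Bool) (m r : ℕ) :
    trotterWalk w m r ∈ unitary (QOp n) := by
  rw [trotterWalk_eq_prod]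
  refine list_prod_mem fun M hM => ?_
  obtain ⟨t, -, rfl⟩ := List.mem_map.1 hM
  exact strangStep_mem_unitary w t

theorem norm_pow_sub_pow_le_of_norm_le_one {A : Type*} [NormedRing A] [NormOneClass A] {x y : A}
    (hx : ‖x‖ ≤ 1) (hy : ‖y‖ ≤ 1) (r : ℕ) : ‖x ^ r - y ^ r‖ ≤ r * ‖x - y‖ := by
  induction r with
  | zero => simp
  | succ r ih =>
    have h : x ^ (r + 1) - y ^ (r + 1) = (x ^ r - y ^ r) * x + y ^ r * (x - y) := by
      rw [pow_succ, pow_succ]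
      noncomm_ring
    have hyr : ‖y ^ r‖ ≤ 1 := (norm_pow_le y r).trans (pow_le_one₀ (norm_nonneg y) hy)
    rw [h]
    calc _ ≤ ‖(x ^ r - y ^ r) * x‖ + ‖y ^ r * (x - y)‖ := norm_add_le _ _
      _ ≤ r * ‖x - y‖ * 1 + 1 * ‖x - y‖ :=
          add_le_add (norm_mul_le_of_le ih hx) (norm_mul_le_of_le hyr le_rfl)
      _ = _ := by push_cast; ring

/-- Both one-step operators are unitary, so step errors add up. The base `3^(m+1)` comes from `‖H₁‖
+ ‖H₂‖ ≤ 1 + 2`. -/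
theorem norm_trotterWalk_sub_evolve_le (w : Fin n → Bool) (m : ℕ) {r : ℕ} (hr : 1 ≤ r)
    (hT : tStar n * 3 ^ (m + 1) ≤ r) :
    ‖trotterWalk w m r - evolve (walkHamiltonian w) (tStar n)‖ ≤
      r * (2 * Real.exp 1 * (tStar n * 3 ^ (m + 1) / r) ^ (2 * m + 3)) := by
  have hr0 : (0 : ℝ) < r := by exact_mod_cast hr
  have hτ : 0 ≤ tStar n := by unfold tStar; positivity
  set H₁ : QOp n := (-Complex.I) • Hw w with hH₁
  set H₂ : QOp n := (-Complex.I * (alphaStar n : ℂ)) • Hx n with hH₂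
  have hα : 0 ≤ alphaStar n := by
    unfold alphaStar
    positivity
  have hn1 : ‖H₁‖ ≤ 1 := by
    rw [hH₁, norm_smul, norm_neg, Complex.norm_I, one_mul]
    exact norm_Hw_le w
  have hn2 : ‖H₂‖ ≤ 2 := by
    rw [hH₂, norm_smul, norm_mul, norm_neg, Complex.norm_I, one_mul, Complex.norm_real,
      Real.norm_eq_abs, abs_of_nonneg hα]
    calc _ ≤ alphaStar n * n := by gcongr; exact norm_Hx_le
      _ ≤ 2 := alphaStar_mul_le n
  have hsum : H₁ + H₂ = (-Complex.I) • walkHamiltonian w := by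
    rw [hH₁, hH₂, walkHamiltonian, smul_add, smul_smul, add_comm]
  set t : ℝ := tStar n / r with ht
  have hnt : ‖(t : ℂ)‖ = t := by
    rw [Complex.norm_real, Real.norm_eq_abs, abs_of_nonneg (by positivity)]
  have hU : NormedSpace.exp ((t : ℂ) • (H₁ + H₂)) = evolve (walkHamiltonian w) t := by
    rw [hsum, smul_smul, evolve, mul_comm]
  have hpow : evolve (walkHamiltonian w) t ^ r = evolve (walkHamiltonian w) (tStar n) := by
    rw [evolve, exp_natCast_smul, evolve]
    congr 2
    have : (r : ℂ) ≠ 0 := by exact_mod_cast hr0.ne'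
    rw [ht]
    push_cast
    field_simp
  have hS : suzuki H₁ H₂ m t ∈ unitary (QOp n) := by
    rw [hH₁, hH₂, suzuki_walk_eq_prod]
    refine list_prod_mem fun M hM => ?_
    obtain ⟨t, -, rfl⟩ := List.mem_map.1 hM
    exact strangStep_mem_unitary w t
  have hone := norm_suzukiC_sub_exp_le H₁ H₂ m (L := 3 ^ (m + 1)) (by positivity)
    (by rw [pow_succ, mul_comm ((3 : ℝ) ^ m)]; gcongr; linarith) (z := (t : ℂ))
    (by rw [hnt, ht, div_mul_eq_mul_div, div_le_one hr0]; exact hT)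
  rw [← suzuki_eq_suzukiC, hU, hnt] at hone
  calc ‖trotterWalk w m r - evolve (walkHamiltonian w) (tStar n)‖
      = ‖suzuki H₁ H₂ m t ^ r - evolve (walkHamiltonian w) t ^ r‖ := by rw [hpow, trotterWalk]
    _ ≤ r * ‖suzuki H₁ H₂ m t - evolve (walkHamiltonian w) t‖ :=
        norm_pow_sub_pow_le_of_norm_le_one (CStarRing.norm_of_mem_unitary hS).le
          (CStarRing.norm_of_mem_unitary
            (evolve_mem_unitary (isSelfAdjoint_walkHamiltonian w) t)).le r
    _ ≤ _ := by
        rw [div_mul_eq_mul_div] at hone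
        gcongr

theorem norm_mulVec_of_mem_unitary {U : QOp n} (hU : U ∈ unitary (QOp n)) (v : QVec n) :
    ‖WithLp.toLp 2 (U.mulVec v)‖ = ‖WithLp.toLp 2 v‖ := by
  rw [← Matrix.toEuclideanCLM_toLp]
  exact ContinuousLinearMap.norm_map_of_mem_unitary
    (Unitary.map_mem (Matrix.toEuclideanCLM (𝕜 := ℂ) (n := Fin n → Bool)) hU) _

theorem abs_overlap_trotterWalk_sub_one_le (hn : 38 ≤ n) (w : Fin n → Bool) {m r : ℕ} {δ : ℝ}
    (h : ‖trotterWalk w m r - evolve (walkHamiltonian w) (tStar n)‖ ≤ δ) :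
    |overlap w ((trotterWalk w m r).mulVec (plusState n)) - 1| ≤ (δ + 3 * √(38 / n)) ^ 2 := by
  obtain ⟨c, hc⟩ := exists_norm_walk_sub_le hn w
  refine abs_overlap_sub_one_le (c := c)
    ((norm_mulVec_of_mem_unitary (trotterWalk_mem_unitary w m r) _).trans norm_plusState) ?_
  have h1 := Matrix.l2_opNorm_mulVec (trotterWalk w m r - evolve (walkHamiltonian w) (tStar n))
    (WithLp.toLp 2 (plusState n))
  rw [norm_plusState, mul_one, Matrix.sub_mulVec] at h1
  have h2 := norm_sub_le_norm_sub_add_norm_sub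
    (WithLp.toLp 2 ((trotterWalk w m r).mulVec (plusState n)))
    (WithLp.toLp 2 ((evolve (walkHamiltonian w) (tStar n)).mulVec (plusState n)))
    (c • WithLp.toLp 2 (ket w))
  refine h2.trans (add_le_add (le_trans ?_ h) hc)
  exact h1

end Trotter

/-! ### From products of Strang steps to QAOA angles. -/

section Circuit

variable {n : ℕ}

/-- The ordered product `S (τ p) * ⋯ * S (τ 1)`. -/
noncomputable def orderedProd (S : ℝ → QOp n) (τ : ℕ → ℝ) : ℕ → QOp n
  | 0 => 1
  | p + 1 => S (τ (p + 1)) * orderedProd S τ p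

theorem orderedProd_congr (S : ℝ → QOp n) {τ τ' : ℕ → ℝ} {p : ℕ} (h : ∀ k ≤ p, τ k = τ' k) :
    orderedProd S τ p = orderedProd S τ' p := by
  induction p with
  | zero => rfl
  | succ p ih => rw [orderedProd, orderedProd, h _ le_rfl, ih fun k hk => h k (by omega)]

/-- One sequence of durations serves every `S`, hence every target. Its vanishing beyond the length
removes the last half rotation in `orderedProd_strangStep`. -/
theorem exists_orderedProd (l : List ℝ) :
    ∃ τ : ℕ → ℝ, (∀ k, l.length < k → τ k = 0) ∧
      ∀ S : ℝ → QOp n, (l.map S).prod = orderedProd S τ l.length := by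
  induction l with
  | nil => exact ⟨0, fun _ _ => rfl, fun S => rfl⟩
  | cons t l ih =>
    obtain ⟨τ, h0, h⟩ := ih
    refine ⟨Function.update τ (l.length + 1) t, fun k hk => ?_, fun S => ?_⟩
    · rw [List.length_cons] at hk
      rw [Function.update_of_ne (by omega), h0 k (by omega)]
    · rw [List.map_cons, List.prod_cons, h, List.length_cons, orderedProd, Function.update_self]
      congr 1
      exact orderedProd_congr S fun k hk => by rw [Function.update_of_ne (by omega)]

/-- Adjacent half rotations by `Hx` merge into one layer; the factor on the left compensates for the
half step that layer `p` borrows from step `p + 1`. -/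
theorem orderedProd_strangStep (w : Fin n → Bool) (τ : ℕ → ℝ) (p : ℕ) :
    orderedProd (strangStep w) τ p =
      evolve (Hx n) (-(alphaStar n * τ (p + 1) / 2)) *
        qaoaCircuit w τ (fun k => alphaStar n * τ k / 2 + alphaStar n * τ (k + 1) / 2) p *
        evolve (Hx n) (alphaStar n * τ 1 / 2) := by
  induction p with
  | zero => rw [orderedProd, qaoaCircuit, mul_one, ← evolve_add, neg_add_cancel, evolve_zero]
  | succ p ih =>
    rw [orderedProd, ih, qaoaCircuit, strangStep]
    have h1 : evolve (Hx n) (alphaStar n * τ (p + 1) / 2) =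
        evolve (Hx n) (-(alphaStar n * τ (p + 1 + 1) / 2)) *
          evolve (Hx n) (alphaStar n * τ (p + 1) / 2 + alphaStar n * τ (p + 1 + 1) / 2) := by
      rw [← evolve_add]
      ring_nf
    have h2 : ∀ M : QOp n, evolve (Hx n) (alphaStar n * τ (p + 1) / 2) *
        (evolve (Hx n) (-(alphaStar n * τ (p + 1) / 2)) * M) = M := fun M => by
      rw [← mul_assoc, ← evolve_add, add_neg_cancel, evolve_zero, one_mul]
    simp only [mul_assoc, h2]
    rw [h1]
    simp only [mul_assoc]

theorem evolve_Hw_int_mul_two_pi (w : Fin n → Bool) (j : ℤ) :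
    evolve (Hw w) (j * (2 * Real.pi)) = 1 := by
  refine ext_mulVec_ket fun y => ?_
  by_cases h : y = w
  · subst h
    have hv : ((-Complex.I * ((j * (2 * Real.pi) : ℝ) : ℂ)) • Hw y).mulVec (ket y) =
        (-Complex.I * ((j * (2 * Real.pi) : ℝ) : ℂ)) • ket y := by
      rw [Matrix.smul_mulVec, Hw_mulVec]
      simp [ket]
    rw [evolve, exp_mulVec_of_eigenvector hv, Matrix.one_mulVec]
    have : -Complex.I * ((j * (2 * Real.pi) : ℝ) : ℂ) =
        ((-j : ℤ) : ℂ) * (2 * Real.pi * Complex.I) := by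
      push_cast
      ring
    rw [this, Complex.exp_int_mul_two_pi_mul_I, one_smul]
  · have hv : ((-Complex.I * ((j * (2 * Real.pi) : ℝ) : ℂ)) • Hw w).mulVec (ket y) =
        (0 : ℂ) • ket y := by
      rw [Matrix.smul_mulVec, Hw_mulVec]
      simp [ket, Ne.symm h]
    rw [evolve, exp_mulVec_of_eigenvector hv, Matrix.one_mulVec]
    simp

/-- The eigenvalues `n - 2k` of `Hx` share a parity, so time `π` already acts as a scalar. -/
theorem evolve_Hx_int_mul_pi (j : ℤ) :
    evolve (Hx n) (j * Real.pi) =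
      Complex.exp (Complex.I * ((-(n * j * Real.pi) : ℝ) : ℂ)) • (1 : QOp n) := by
  have hS : ∀ S : Finset (Fin n), (evolve (Hx n) (j * Real.pi)).mulVec (walshVec S) =
      Complex.exp (Complex.I * ((-(n * j * Real.pi) : ℝ) : ℂ)) • walshVec S := by
    intro S
    have hv : ((-Complex.I * ((j * Real.pi : ℝ) : ℂ)) • Hx n).mulVec (walshVec S) =
        (Complex.I * ((-(n * j * Real.pi) : ℝ) : ℂ) +
          ((j * S.card : ℤ) : ℂ) * (2 * Real.pi * Complex.I)) • walshVec S := by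
      rw [Matrix.smul_mulVec, Hx_mulVec_walshVec, smul_smul]
      congr 1
      push_cast
      ring
    rw [evolve, exp_mulVec_of_eigenvector hv, Complex.exp_add, Complex.exp_int_mul_two_pi_mul_I,
      mul_one]
  refine ext_mulVec_ket fun w => ?_
  rw [Matrix.smul_mulVec, Matrix.one_mulVec, ket_eq_walsh, Matrix.mulVec_sum, Finset.smul_sum]
  refine Finset.sum_congr rfl fun S _ => ?_
  rw [Matrix.mulVec_smul, hS, smul_comm]

theorem evolve_Hw_toIcoMod (w : Fin n → Bool) (γ : ℝ) :
    evolve (Hw w) γ = evolve (Hw w) (toIcoMod Real.two_pi_pos 0 γ) := by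
  conv_lhs => rw [← toIcoMod_add_toIcoDiv_zsmul Real.two_pi_pos 0 γ]
  rw [zsmul_eq_mul, evolve_add, evolve_Hw_int_mul_two_pi, mul_one]

theorem exists_evolve_Hx_toIcoMod (n : ℕ) (β : ℝ) :
    ∃ φ : ℝ, evolve (Hx n) β =
      Complex.exp (Complex.I * (φ : ℂ)) • evolve (Hx n) (toIcoMod Real.pi_pos 0 β) := by
  refine ⟨-(n * toIcoDiv Real.pi_pos 0 β * Real.pi), ?_⟩
  conv_lhs => rw [← toIcoMod_add_toIcoDiv_zsmul Real.pi_pos 0 β]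
  rw [zsmul_eq_mul, evolve_add, evolve_Hx_int_mul_pi, mul_smul_comm, mul_one]

/-- Reduction is needed since the durations with factor `1 - 4u` are negative. Only the `Hx`
rotations contribute phases, so `φ` is the same for all targets. -/
theorem exists_qaoaCircuit_toIcoMod (n : ℕ) (γ β : ℕ → ℝ) (p : ℕ) :
    ∃ φ : ℝ, ∀ w : Fin n → Bool, qaoaCircuit w γ β p = Complex.exp (Complex.I * (φ : ℂ)) •
      qaoaCircuit w (fun k => toIcoMod Real.two_pi_pos 0 (γ k))
        (fun k => toIcoMod Real.pi_pos 0 (β k)) p := by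
  induction p with
  | zero => exact ⟨0, fun w => by simp [qaoaCircuit]⟩
  | succ p ih =>
    obtain ⟨φ, h⟩ := ih
    obtain ⟨φ', h'⟩ := exists_evolve_Hx_toIcoMod n (β (p + 1))
    refine ⟨φ' + φ, fun w => ?_⟩
    rw [qaoaCircuit, qaoaCircuit, h w, h', evolve_Hw_toIcoMod]
    rw [smul_mul_assoc, smul_mul_assoc, mul_smul_comm, smul_smul, ← Complex.exp_add]
    push_cast
    rw [mul_add]

/-- The Trotter–Suzuki discretization of the walk is a QAOA circuit with angles in the usual
ranges, up to a phase and an initial rotation. -/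
theorem exists_angles (n m r : ℕ) :
    ∃ γ β : ℕ → ℝ, (∀ k, γ k ∈ Set.Ico 0 (2 * Real.pi) ∧ β k ∈ Set.Ico 0 Real.pi) ∧
      ∃ φ θ : ℝ, ∀ w : Fin n → Bool, trotterWalk w m r = Complex.exp (Complex.I * (φ : ℂ)) •
        (qaoaCircuit w γ β (r * 5 ^ m) * evolve (Hx n) θ) := by
  set l := (List.replicate r (suzukiTimes m (tStar n / r))).flatten with hl
  have hlen : l.length = r * 5 ^ m := by
    simp [hl, List.length_flatten, length_suzukiTimes]
  obtain ⟨τ, h0, h⟩ := exists_orderedProd (n := n) l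
  rw [hlen] at h0 h
  obtain ⟨φ, hφ⟩ := exists_qaoaCircuit_toIcoMod n τ
    (fun k => alphaStar n * τ k / 2 + alphaStar n * τ (k + 1) / 2) (r * 5 ^ m)
  refine ⟨fun k => toIcoMod Real.two_pi_pos 0 (τ k),
    fun k => toIcoMod Real.pi_pos 0 (alphaStar n * τ k / 2 + alphaStar n * τ (k + 1) / 2),
    fun k => ⟨?_, ?_⟩, φ, alphaStar n * τ 1 / 2, fun w => ?_⟩
  · simpa using toIcoMod_mem_Ico Real.two_pi_pos 0 (τ k)
  · simpa using toIcoMod_mem_Ico Real.pi_pos 0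
      (alphaStar n * τ k / 2 + alphaStar n * τ (k + 1) / 2)
  · rw [trotterWalk_eq_prod, ← hl, h, orderedProd_strangStep, h0 _ (Nat.lt_succ_self _), mul_zero,
      zero_div, neg_zero, evolve_zero, one_mul, hφ, smul_mul_assoc]

theorem overlap_smul (w : Fin n → Bool) {c : ℂ} (hc : ‖c‖ = 1) (ψ : QVec n) :
    overlap w (c • ψ) = overlap w ψ := by
  rw [overlap, overlap, dotProduct_smul, norm_smul, hc, one_mul]

theorem overlap_qaoaState {w : Fin n → Bool} {γ β : ℕ → ℝ} {p m r : ℕ} {φ θ : ℝ}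
    (h : trotterWalk w m r = Complex.exp (Complex.I * (φ : ℂ)) •
      (qaoaCircuit w γ β p * evolve (Hx n) θ)) :
    overlap w (qaoaState w γ β p) = overlap w ((trotterWalk w m r).mulVec (plusState n)) := by
  have hphase : ∀ x : ℝ, ‖Complex.exp (Complex.I * (x : ℂ))‖ = 1 := fun x => by
    rw [mul_comm, Complex.norm_exp_ofReal_mul_I]
  have hv : ((-Complex.I * (θ : ℂ)) • Hx n).mulVec (plusState n) =
      (Complex.I * ((-(n * θ) : ℝ) : ℂ)) • plusState n := by
    rw [Matrix.smul_mulVec, Hx_mulVec_plusState, smul_smul]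
    congr 1
    push_cast
    ring
  rw [h, Matrix.smul_mulVec, ← Matrix.mulVec_mulVec, evolve, exp_mulVec_of_eigenvector hv,
    Matrix.mulVec_smul, overlap_smul w (hphase _), overlap_smul w (hphase _), qaoaState]

end Circuit

/-! ### Choice of order and number of steps; the depth bound. -/

section Parameters

/-- The limit `√(log 2 / (2 log 5))` of `q / √n`. -/
noncomputable def orderRate : ℝ := √(Real.log 2 / (2 * Real.log 5))

/-- The order of the formula is `q = 2 (orderIndex n + 1)`. -/
noncomputable def orderIndex (n : ℕ) : ℕ := ⌈orderRate * √n / 2⌉₊ - 1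

/-- The product of the walk time and a bound for the growth rate of the formula. -/
noncomputable def growthTime (n : ℕ) : ℝ := tStar n * 3 ^ (orderIndex n + 1)

/-- The number of Trotter–Suzuki steps. -/
noncomputable def stepCount (n : ℕ) : ℕ :=
  ⌈growthTime n * (growthTime n * n) ^ (1 / (2 * ((orderIndex n : ℝ) + 1)))⌉₊

theorem orderRate_pos : 0 < orderRate := by
  have h2 : 0 < Real.log 2 := Real.log_pos (by norm_num)
  have h5 : 0 < Real.log 5 := Real.log_pos (by norm_num)
  unfold orderRate
  positivity

theorem order_bounds {n : ℕ} (hn : 1 ≤ n) :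
    orderRate * √n ≤ 2 * ((orderIndex n : ℝ) + 1) ∧
      2 * ((orderIndex n : ℝ) + 1) ≤ orderRate * √n + 2 := by
  have hn' : (0 : ℝ) < n := by exact_mod_cast hn
  have h0 : 0 < orderRate * √n / 2 := by
    have := orderRate_pos
    positivity
  have h1 : (orderIndex n : ℝ) + 1 = (⌈orderRate * √n / 2⌉₊ : ℝ) := by
    have : 1 ≤ ⌈orderRate * √n / 2⌉₊ := Nat.ceil_pos.2 h0
    rw [orderIndex, Nat.cast_sub this]
    simp
  have h2 := Nat.le_ceil (orderRate * √n / 2)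
  have h3 := Nat.ceil_lt_add_one h0.le
  rw [h1]
  constructor <;> linarith

theorem tendsto_order_div_sqrt :
    Tendsto (fun n : ℕ => (2 * ((orderIndex n : ℝ) + 1)) / √(n : ℝ)) atTop (𝓝 orderRate) := by
  have hs : Tendsto (fun n : ℕ => √(n : ℝ)) atTop atTop :=
    Real.tendsto_sqrt_atTop.comp tendsto_natCast_atTop_atTop
  have h : Tendsto (fun n : ℕ => orderRate + 2 / √(n : ℝ)) atTop (𝓝 orderRate) := by
    simpa using (hs.const_div_atTop 2).const_add orderRate
  refine tendsto_of_tendsto_of_tendsto_of_le_of_le' tendsto_const_nhds h ?_ ?_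
  · filter_upwards [eventually_ge_atTop 1] with n hn
    have hn' : (0 : ℝ) < n := by exact_mod_cast hn
    rw [le_div_iff₀ (by positivity)]
    exact (order_bounds hn).1
  · filter_upwards [eventually_ge_atTop 1] with n hn
    have hn' : (0 : ℝ) < √n := Real.sqrt_pos.2 (by exact_mod_cast hn)
    rw [div_le_iff₀ hn', add_mul, div_mul_cancel₀ _ hn'.ne']
    exact (order_bounds hn).2

theorem one_le_tStar (n : ℕ) : 1 ≤ tStar n := by
  have h1 : 1 ≤ √((2 : ℝ) ^ n) := Real.one_le_sqrt.2 (one_le_pow₀ (by norm_num))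
  have h2 : 1 ≤ Real.pi / 2 := by linarith [Real.pi_gt_three]
  exact one_le_mul_of_one_le_of_one_le h2 h1

theorem one_le_growthTime (n : ℕ) : 1 ≤ growthTime n :=
  one_le_mul_of_one_le_of_one_le (one_le_tStar n) (one_le_pow₀ (by norm_num))

theorem growthTime_le_stepCount {n : ℕ} (hn : 1 ≤ n) : growthTime n ≤ stepCount n := by
  have hn' : (1 : ℝ) ≤ n := by exact_mod_cast hn
  refine le_trans ?_ (Nat.le_ceil _)
  refine le_mul_of_one_le_right (by linarith [one_le_growthTime n]) ?_
  exact Real.one_le_rpow (one_le_mul_of_one_le_of_one_le (one_le_growthTime n) hn')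
    (by positivity)

theorem one_le_stepCount {n : ℕ} (hn : 1 ≤ n) : 1 ≤ stepCount n := by
  have := (one_le_growthTime n).trans (growthTime_le_stepCount hn)
  exact_mod_cast this

theorem trotter_error_le {n : ℕ} (hn : 1 ≤ n) (w : Fin n → Bool) :
    ‖trotterWalk w (orderIndex n) (stepCount n) - evolve (walkHamiltonian w) (tStar n)‖ ≤
      6 / n := by
  refine (norm_trotterWalk_sub_evolve_le w (orderIndex n) (one_le_stepCount hn)
    (growthTime_le_stepCount hn)).trans ?_
  have hn' : (1 : ℝ) ≤ n := by exact_mod_cast hn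
  have hT1 := one_le_growthTime n
  have hr1 : (1 : ℝ) ≤ stepCount n := by exact_mod_cast one_le_stepCount hn
  have hle : growthTime n * (growthTime n * n) ^ (1 / (2 * ((orderIndex n : ℝ) + 1))) ≤
      stepCount n := Nat.le_ceil _
  rw [← growthTime]
  set T := growthTime n
  set r : ℝ := (stepCount n : ℝ)
  set m := orderIndex n
  have hTn : 0 < T * n := by positivity
  -- The exponent `1/q` in `stepCount` is chosen for this: of the `q + 1` powers of `T / r`, one
  -- cancels the factor `r` and the other `q` give `1 / (T n)`.
  have hpow : (T / r) ^ (2 * m + 2) ≤ 1 / (T * n) := by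
    have h1 : (T * n) ^ (1 / (2 * ((m : ℝ) + 1))) ≤ r / T := by
      rw [le_div_iff₀ (by positivity)]
      linarith
    have h2 : T * n ≤ (r / T) ^ (2 * m + 2) := by
      calc T * n = ((T * n) ^ (1 / (2 * ((m : ℝ) + 1)))) ^ (2 * m + 2) := by
            rw [← Real.rpow_natCast, ← Real.rpow_mul hTn.le]
            push_cast
            rw [show (1 : ℝ) / (2 * (m + 1)) * (2 * m + 2) = 1 by field_simp, Real.rpow_one]
        _ ≤ _ := by gcongr
    rw [← inv_div r T, inv_pow, one_div]
    gcongr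
  calc r * (2 * Real.exp 1 * (T / r) ^ (2 * m + 3))
      = 2 * Real.exp 1 * T * (T / r) ^ (2 * m + 2) := by
        rw [show 2 * m + 3 = 2 * m + 2 + 1 by ring, pow_succ]
        field_simp
    _ ≤ 2 * Real.exp 1 * T * (1 / (T * n)) := by gcongr
    _ = 2 * Real.exp 1 / n := by field_simp
    _ ≤ 6 / n := by
        gcongr
        linarith [Real.exp_one_lt_d9]

theorem abs_overlap_sub_one_le_div {n : ℕ} (hn : 1 ≤ n) (w : Fin n → Bool) :
    |overlap w ((trotterWalk w (orderIndex n) (stepCount n)).mulVec (plusState n)) - 1| ≤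
      676 / n := by
  have hn' : (1 : ℝ) ≤ n := by exact_mod_cast hn
  rcases le_or_gt 38 n with h38 | h38
  · refine (abs_overlap_trotterWalk_sub_one_le h38 w (trotter_error_le hn w)).trans ?_
    have hs : 0 < √(n : ℝ) := by positivity
    have h1 : (6 : ℝ) / n ≤ 6 / √n := by
      gcongr
      rw [Real.sqrt_le_left (by linarith)]
      nlinarith
    have h2 : √((38 : ℝ) / n) ≤ (20 / 3) / √n := by
      rw [Real.sqrt_div (by norm_num)]
      gcongr
      rw [Real.sqrt_le_left (by norm_num)]
      norm_num
    have h3 : (6 : ℝ) / n + 3 * √(38 / n) ≤ 26 / √n := by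
      calc (6 : ℝ) / n + 3 * √(38 / n) ≤ 6 / √n + 3 * ((20 / 3) / √n) := by gcongr
        _ = 26 / √n := by ring
    calc ((6 : ℝ) / n + 3 * √(38 / n)) ^ 2 ≤ (26 / √(n : ℝ)) ^ 2 := by gcongr
      _ = 676 / (n : ℝ) := by
          rw [div_pow, Real.sq_sqrt (by linarith)]
          norm_num
  -- For `n < 38` the claim is trivial because `676 / n > 1`; here `676 = 26²`.
  · refine (overlap_le_one ((norm_mulVec_of_mem_unitary
      (trotterWalk_mem_unitary w _ _) _).trans norm_plusState)).trans ?_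
    rw [le_div_iff₀ (by linarith)]
    have : (n : ℝ) < 38 := by exact_mod_cast h38
    linarith

theorem sqrt_two_pow (n : ℕ) : √((2 : ℝ) ^ n) = 2 ^ ((n : ℝ) / 2) := by
  rw [Real.sqrt_eq_rpow, ← Real.rpow_natCast, ← Real.rpow_mul (by norm_num)]
  ring_nf

/-- For `q ≈ ρ √n` the exponent of the depth beyond `n/2` is `√n (ρ log₂ 5 + 1/(2ρ))`; `orderRate`
is the minimizer, where both terms are equal. -/
theorem orderRate_identity :
    orderRate * Real.logb 2 5 + 1 / (2 * orderRate) = √(2 * Real.logb 2 5) := by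
  have h2 : 0 < Real.log 2 := Real.log_pos (by norm_num)
  have h5 : 0 < Real.log 5 := Real.log_pos (by norm_num)
  have hl : 0 < Real.logb 2 5 := div_pos h5 h2
  have hs : orderRate = 1 / √(2 * Real.logb 2 5) := by
    rw [orderRate, ← Real.sqrt_one, ← Real.sqrt_div (by norm_num), Real.logb]
    congr 1
    field_simp
  have hD : 0 < √(2 * Real.logb 2 5) := by positivity
  have hsq := Real.mul_self_sqrt (show 0 ≤ 2 * Real.logb 2 5 by positivity)
  rw [hs]
  field_simp
  nlinarith

theorem depth_le {n : ℕ} (hn : 1 ≤ n) :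
    ((stepCount n * 5 ^ orderIndex n : ℕ) : ℝ) ≤ 72 * Real.exp (2 / orderRate) *
      (2 : ℝ) ^ ((n : ℝ) / 2 + √(n : ℝ) * √(2 * Real.logb 2 5)) := by
  have hn' : (1 : ℝ) ≤ n := by exact_mod_cast hn
  have hs0 := orderRate_pos
  have hsn : 0 < √(n : ℝ) := by positivity
  obtain ⟨hq1, hq2⟩ := order_bounds hn
  have hT1 := one_le_growthTime n
  set m := orderIndex n with hm
  set q : ℝ := 2 * ((m : ℝ) + 1) with hq
  have hq0 : 2 ≤ q := by
    rw [hq]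
    linarith [(m.cast_nonneg : (0 : ℝ) ≤ m)]
  set T := growthTime n with hT
  set X : ℝ := 2 ^ ((n : ℝ) / 2) with hX
  have hX0 : 0 < X := by positivity
  have hTX : T ≤ 2 * X * 3 ^ (m + 1) := by
    rw [hT, growthTime, tStar, sqrt_two_pow]
    gcongr
    linarith [Real.pi_le_four]
  have hTn : 0 ≤ T * n := by positivity
  have hceil : (stepCount n : ℝ) ≤ 2 * (T * (T * n) ^ (1 / q)) := by
    have h1 : 1 ≤ T * (T * n) ^ (1 / q) :=
      one_le_mul_of_one_le_of_one_le hT1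
        (Real.one_le_rpow (one_le_mul_of_one_le_of_one_le hT1 hn') (by positivity))
    have h2 : (stepCount n : ℝ) < T * (T * n) ^ (1 / q) + 1 := Nat.ceil_lt_add_one (by linarith)
    linarith
  have hroot2 : (2 : ℝ) ^ (1 / q) ≤ 2 := by
    calc (2 : ℝ) ^ (1 / q) ≤ 2 ^ (1 : ℝ) := by
          apply Real.rpow_le_rpow_of_exponent_le (by norm_num)
          rw [div_le_one (by linarith)]
          linarith
      _ = 2 := Real.rpow_one 2
  have hroot3 : ((3 : ℝ) ^ (m + 1)) ^ (1 / q) ≤ 3 := by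
    rw [← Real.rpow_natCast, ← Real.rpow_mul (by norm_num)]
    calc (3 : ℝ) ^ (((m + 1 : ℕ) : ℝ) * (1 / q)) ≤ 3 ^ (1 : ℝ) := by
          apply Real.rpow_le_rpow_of_exponent_le (by norm_num)
          rw [mul_one_div, div_le_one (by linarith)]
          push_cast
          rw [hq]
          linarith [(m.cast_nonneg : (0 : ℝ) ≤ m)]
      _ = 3 := Real.rpow_one 3
  have hrootX : X ^ (1 / q) ≤ 2 ^ (√(n : ℝ) * (1 / (2 * orderRate))) := by
    rw [hX, ← Real.rpow_mul (by norm_num)]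
    apply Real.rpow_le_rpow_of_exponent_le (by norm_num)
    calc (n : ℝ) / 2 * (1 / q) ≤ n / 2 * (1 / (orderRate * √n)) := by gcongr
      _ = √n * √n / 2 * (1 / (orderRate * √n)) := by rw [Real.mul_self_sqrt (by linarith)]
      _ = _ := by field_simp
  -- Bounded because `q` grows like `√n`, which dominates `log n`.
  have hrootn : (n : ℝ) ^ (1 / q) ≤ Real.exp (2 / orderRate) := by
    rw [Real.rpow_def_of_pos (by linarith)]
    apply Real.exp_le_exp.2
    have h1 : Real.log n ≤ 2 * √n := by
      have h2 := Real.log_le_sub_one_of_pos hsn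
      rw [Real.log_sqrt (by linarith)] at h2
      linarith
    calc Real.log n * (1 / q) ≤ 2 * √n * (1 / (orderRate * √n)) := by gcongr
      _ = 2 / orderRate := by field_simp
  have hroot : (T * n) ^ (1 / q) ≤
      2 * 2 ^ (√(n : ℝ) * (1 / (2 * orderRate))) * 3 * Real.exp (2 / orderRate) := by
    rw [Real.mul_rpow (by linarith) (by linarith)]
    gcongr
    calc T ^ (1 / q) ≤ (2 * X * 3 ^ (m + 1)) ^ (1 / q) := by gcongr
      _ = 2 ^ (1 / q) * X ^ (1 / q) * (3 ^ (m + 1)) ^ (1 / q) := by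
          rw [Real.mul_rpow (by positivity) (by positivity), Real.mul_rpow (by norm_num) hX0.le]
      _ ≤ _ := by gcongr
  -- The growth factor `3^m` is absorbed through `15 ≤ 25`, so `3^m 5^m` costs at most `5^(2m) =
  -- 5^(q-2)`.
  have h15 : (3 : ℝ) ^ (m + 1) * 5 ^ m ≤ 3 * 2 ^ (√(n : ℝ) * (orderRate * Real.logb 2 5)) := by
    have h25 : (5 : ℝ) ^ (2 * m) ≤ 2 ^ (√(n : ℝ) * (orderRate * Real.logb 2 5)) := by
      calc (5 : ℝ) ^ (2 * m) = 5 ^ (2 * (m : ℝ)) := by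
            rw [← Real.rpow_natCast]
            push_cast
            rfl
        _ ≤ 5 ^ (orderRate * √n) := by
            apply Real.rpow_le_rpow_of_exponent_le (by norm_num)
            rw [hq] at hq2
            linarith
        _ = _ := by
            rw [show √(n : ℝ) * (orderRate * Real.logb 2 5) =
              Real.logb 2 5 * (orderRate * √n) by ring, Real.rpow_mul (by norm_num : (0 : ℝ) ≤ 2),
              Real.rpow_logb (by norm_num) (by norm_num) (by norm_num)]
    calc (3 : ℝ) ^ (m + 1) * 5 ^ m = 3 * (3 ^ m * 5 ^ m) := by ring
      _ ≤ 3 * (5 ^ m * 5 ^ m) := by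
          gcongr
          norm_num
      _ = 3 * 5 ^ (2 * m) := by rw [two_mul, pow_add]
      _ ≤ _ := by gcongr
  have hexp : (2 : ℝ) ^ ((n : ℝ) / 2 + √(n : ℝ) * √(2 * Real.logb 2 5)) =
      X * 2 ^ (√(n : ℝ) * (orderRate * Real.logb 2 5)) *
        2 ^ (√(n : ℝ) * (1 / (2 * orderRate))) := by
    rw [← orderRate_identity, mul_add, ← add_assoc, Real.rpow_add (by norm_num),
      Real.rpow_add (by norm_num)]
  rw [hexp]
  push_cast
  calc (stepCount n : ℝ) * 5 ^ m ≤ 2 * (T * (T * n) ^ (1 / q)) * 5 ^ m := by gcongr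
    _ ≤ 2 * (2 * X * 3 ^ (m + 1) *
          (2 * 2 ^ (√(n : ℝ) * (1 / (2 * orderRate))) * 3 * Real.exp (2 / orderRate))) *
          5 ^ m := by gcongr
    _ = 24 * Real.exp (2 / orderRate) * X * (3 ^ (m + 1) * 5 ^ m) *
          2 ^ (√(n : ℝ) * (1 / (2 * orderRate))) := by ring
    _ ≤ 24 * Real.exp (2 / orderRate) * X *
          (3 * 2 ^ (√(n : ℝ) * (orderRate * Real.logb 2 5))) *
          2 ^ (√(n : ℝ) * (1 / (2 * orderRate))) := by gcongr
    _ = _ := by ring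

/-- By completing the square, `√n D ≤ D²/(4c) + c n`. -/
theorem two_rpow_add_sqrt_mul_le (n : ℕ) (D : ℝ) {c : ℝ} (hc : 0 < c) :
    (2 : ℝ) ^ ((n : ℝ) / 2 + √(n : ℝ) * D) ≤
      2 ^ (D ^ 2 / (4 * c)) * ((2 : ℝ) ^ n) ^ (1 / 2 + c) := by
  rw [← Real.rpow_natCast 2 n, ← Real.rpow_mul (by norm_num), ← Real.rpow_add (by norm_num)]
  apply Real.rpow_le_rpow_of_exponent_le (by norm_num)
  have h1 := Real.mul_self_sqrt (n.cast_nonneg : (0 : ℝ) ≤ n)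
  have h2 : √(n : ℝ) * D ≤ D ^ 2 / (4 * c) + c * (√n * √n) := by
    have : D ^ 2 / (4 * c) + c * (√n * √n) - √(n : ℝ) * D = (D - 2 * c * √n) ^ 2 / (4 * c) := by
      field_simp
      ring
    have : 0 ≤ (D - 2 * c * √n) ^ 2 / (4 * c) := by positivity
    linarith
  rw [h1] at h2
  linarith

end Parameters

end L2Operator

/-! ### Assembly. -/

theorem theorem1 :
    ∃ (m r p : ℕ → ℕ) (γ β : ℕ → ℕ → ℝ),
      -- the angles lie in the usual ranges
      (∀ n : ℕ, ∀ k ∈ Finset.Icc 1 (p n),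
        γ n k ∈ Set.Ico 0 (2 * Real.pi) ∧ β n k ∈ Set.Ico 0 Real.pi) ∧
      -- the circuits are the Trotter–Suzuki discretization, of order `q = 2 (m + 1)` with `r` steps,
      -- of the walk, up to a global phase and an initial `H_x` rotation (which fixes `|+⟩^{⊗ n}`
      -- up to a phase)
      (∀ n : ℕ, 1 ≤ n → 1 ≤ r n ∧ p n = r n * 5 ^ m n ∧
        ∃ φ θ : ℝ, ∀ w : Fin n → Bool,
          trotterWalk w (m n) (r n) =
            Complex.exp (Complex.I * (φ : ℂ)) •
              (qaoaCircuit w (γ n) (β n) (p n) * evolve (Hx n) θ)) ∧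
      -- the order of the formula grows like `√n`
      Tendsto (fun n : ℕ => (2 * ((m n : ℝ) + 1)) / √(n : ℝ)) atTop
        (𝓝 √(Real.log 2 / (2 * Real.log 5))) ∧
      -- the depth
      (∃ C : ℝ, ∀ n : ℕ, 1 ≤ n →
        (p n : ℝ) ≤ C * (2 : ℝ) ^ ((n : ℝ) / 2 + √(n : ℝ) * √(2 * Real.logb 2 5))) ∧
      -- the overlap, for every target
      (∃ C : ℝ, ∀ n : ℕ, 1 ≤ n → ∀ w : Fin n → Bool,
        |overlap w (qaoaState w (γ n) (β n) (p n)) - 1| ≤ C / n) ∧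
      -- the depth in terms of `N = 2 ^ n`
      (∀ c : ℝ, 0 < c → ∃ C : ℝ, ∀ n : ℕ, 1 ≤ n →
        (p n : ℝ) ≤ C * ((2 : ℝ) ^ n) ^ (1 / 2 + c)) := by
  -- In `exists_angles` the target is quantified after the angles and phases, so the chosen
  -- functions depend on `n` alone.
  choose γ β hrange φ θ hcircuit using fun n => exists_angles n (orderIndex n) (stepCount n)
  refine ⟨orderIndex, stepCount, fun n => stepCount n * 5 ^ orderIndex n, γ, β,
    fun n k _ => hrange n k,
    fun n hn => ⟨one_le_stepCount hn, rfl, φ n, θ n, hcircuit n⟩, tendsto_order_div_sqrt,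
    ⟨_, fun n hn => depth_le hn⟩, ⟨676, fun n hn w => ?_⟩, fun c hc =>
      ⟨72 * Real.exp (2 / orderRate) * 2 ^ (√(2 * Real.logb 2 5) ^ 2 / (4 * c)),
        fun n hn => (depth_le hn).trans ?_⟩⟩
  · rw [overlap_qaoaState (hcircuit n w)]
    exact abs_overlap_sub_one_le_div hn w
  · exact (mul_le_mul_of_nonneg_left (two_rpow_add_sqrt_mul_le n _ hc) (by positivity)).trans_eq
      (mul_assoc _ _ _).symm
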